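/- Let $B$ be a unital algebra over $\mathbb{C}$, and let $(\mathcal{A},E,\varepsilon)$ be a $B$-$B$-non-commutative probability space. That is, $\mathcal{A}$ is a unital $\mathbb{C}$-algebra, $\varepsilon : B\otimes B^{\mathrm{op}}\to\mathcal{A}$ is a unital homomorphism, injective on $B\otimes 1$ and on $1\otimes B^{\mathrm{op}}$, and $E:\mathcal{A}\to B$ is linear, such that, with $L_b=\varepsilon(b\otimes 1)$ and $R_b=\varepsilon(1\otimes b)$, $$E(L_{b_1}R_{b_2}T)=b_1E(T)b_2,\qquad E(TL_b)=E(TR_b)\qquad (b,b_1,b_2\in B,\ T\in\mathcal{A}).$$ Let $\mathcal{A}_\ell$ be the set of $T\in\mathcal{A}$ commuting with all $R_b$, and $\mathcal{A}_r$ the set of $T\in\mathcal{A}$ commuting with all $L_b$. **Bi-non-crossing partitions.** For $n\ge 1$ and $\chi:\{1,\dots,n\}\to\{\ell,r\}$, let $\prec_\chi$ be the total order on $\{1,\dots,n\}$ that lists first $\chi^{-1}(\ell)$ in increasing order and then $\chi^{-1}(r)$ in decreasing order. A $\chi$-interval is an interval for $\prec_\chi$. $BNC(\chi)$ is the set of partitions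 $\pi$ of $\{1,\dots,n\}$ that are non-crossing for $\prec_\chi$, and $1_\chi$ is the partition with one block. If $S$ is a non-empty union of blocks of $\pi$, then $\pi|_S$ denotes the induced partition of $S$, and $(T_1,\dots,T_n)|_S$ the tuple $(T_k)_{k\in S}$ in increasing order of $k$; both are regarded as indexed by $\{1,\dots,|S|\}$ via the increasing enumeration of $S$. **Moment function.** For $\pi\in BNC(\chi)$ and $T_1,\dots,T_n\in\mathcal{A}$ define $E_\pi(T_1,\dots,T_n)\in B$ recursively. If $\pi=1_\chi$, then $E_\pi(T_1,\dots,T_n)=E(T_1\cdots T_n)$. Otherwise let $V$ be the block of $\pi$ with the largest minimum, put $v=\min V$ and $b=E_{\pi|_V}((T_1,\dots,T_n)|_V)$, and let $C=L_b$ if $\chi(v)=\ell$ and $C=R_b$ if $\chi(v)=r$. * If $V=\{k+1,\dots,n\}$ for some $k\geq 1$, then $E_\pi(T_1,\dots,T_n)=E_{\pi|_{V^c}}(T_1,\dots,T_{k-1},T_kC)$. * Otherwise some block has elements both smaller and larger than $v$ (its spine passes the height of $v$) and does not contain $v$. Let $N$ be the set of all elements larger than $v$ of such blocks. Let $U$ be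 the block (the one whose spine is adjacent to $v$) containing the $\prec_\chi$-least element of $N$ if $\chi(v)=\ell$, and the $\prec_\chi$-greatest element of $N$ if $\chi(v)=r$. With $k=\min\{j\in U: j>v\}$, $$E_\pi(T_1,\dots,T_n)=E_{\pi|_{V^c}}\big((T_1,\dots,T_{k-1},CT_k,T_{k+1},\dots,T_n)|_{V^c}\big).$$ The operator-valued bi-free moment function $\mathcal{E}$ is given by $\mathcal{E}_\pi(T_1,\dots,T_n)=E_\pi(T_1,\dots,T_n)$ for $n\ge1$, $\chi:\{1,\dots,n\}\to\{\ell,r\}$, $\pi\in BNC(\chi)$ and $T_k\in\mathcal{A}_{\chi(k)}$. **Theorem.** $\mathcal{E}$ is bi-multiplicative. That is, $\Phi=\mathcal{E}$ is linear in each argument $T_k\in\mathcal{A}_{\chi(k)}$ and satisfies the following for all $n\ge 1$, all $\chi:\{1,\dots,n\}\to\{\ell,r\}$, all $T_k\in\mathcal{A}_{\chi(k)}$ and all $b\in B$. (i) Let $q=\max\{k:\chi(k)\ne\chi(n)\}$, with $q=-\infty$ if this set is empty. If $\chi(n)=\ell$, then $\Phi_{1_\chi}(T_1,\dots,T_{n-1},T_nL_b)$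 equals $\Phi_{1_\chi}(T_1,\dots,T_qR_b,\dots,T_n)$ if $q\neq-\infty$, and $\Phi_{1_\chi}(T_1,\dots,T_n)\,b$ if $q=-\infty$. If $\chi(n)=r$, then $\Phi_{1_\chi}(T_1,\dots,T_{n-1},T_nR_b)$ equals $\Phi_{1_\chi}(T_1,\dots,T_qL_b,\dots,T_n)$ if $q\ne-\infty$, and $b\,\Phi_{1_\chi}(T_1,\dots,T_n)$ if $q=-\infty$. (ii) Let $p\in\{1,\dots,n\}$ and $q=\max\{k<p:\chi(k)=\chi(p)\}$, with $q=-\infty$ if this set is empty. If $\chi(p)=\ell$, then $\Phi_{1_\chi}(T_1,\dots,L_bT_p,\dots,T_n)$ equals $\Phi_{1_\chi}(T_1,\dots,T_qL_b,\dots,T_n)$ if $q\ne-\infty$, and $b\,\Phi_{1_\chi}(T_1,\dots,T_n)$ if $q=-\infty$. If $\chi(p)=r$, then $\Phi_{1_\chi}(T_1,\dots,R_bT_p,\dots,T_n)$ equals $\Phi_{1_\chi}(T_1,\dots,T_qR_b,\dots,T_n)$ if $q\neq-\infty$, and $\Phi_{1_\chi}(T_1,\dots,T_n)\,b$ if $q=-\infty$.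 (iii) Let $\pi\in BNC(\chi)$, and let $V_1,\dots,V_m$ be non-empty $\chi$-intervals that partition $\{1,\dots,n\}$, each a union of blocks of $\pi$, ordered by $\prec_\chi$. Then $$\Phi_\pi(T_1,\dots,T_n)=\Phi_{\pi|_{V_1}}\big((T_1,\dots,T_n)|_{V_1}\big)\cdots\Phi_{\pi|_{V_m}}\big((T_1,\dots,T_n)|_{V_m}\big).$$ (iv) Let $\pi\in BNC(\chi)$, and let $V,W$ be non-empty and partition $\{1,\dots,n\}$, each a union of blocks of $\pi$, such that $V$ is a $\chi$-interval and $W$ contains the $\prec_\chi$-least and the $\prec_\chi$-greatest element of $\{1,\dots,n\}$. Let $\theta$ be the $\prec_\chi$-greatest element of $W$ preceding all of $V$, let $\gamma$ be the $\prec_\chi$-least element of $W$ following all of $V$, and let $x=\Phi_{\pi|_V}((T_1,\dots,T_n)|_V)$. Then $\Phi_\pi(T_1,\dots,T_n)$ equals $\Phi_{\pi|_W}$ of the restriction to $W$ of the tuple obtained from $(T_1,\dots,T_n)$ by replacing $T_\theta$ by $T_\theta L_x$ if $\chi(\theta)=\ell$ and by $R_xT_\theta$ if $\chi(\theta)=r$.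 It also equals $\Phi_{\pi|_W}$ of the restriction to $W$ of the tuple obtained by replacing $T_\gamma$ by $L_xT_\gamma$ if $\chi(\gamma)=\ell$ and by $T_\gamma R_x$ if $\chi(\gamma)=r$. -/

import Mathlib

open scoped TensorProduct

noncomputable section

namespace BiFree

/-- The two labels `ℓ` and `r`. -/
inductive Side
  | left
  | right

/-! ### `B`-`B`-non-commutative probability spaces -/

/-- A `B`-`B`-non-commutative probability space `(A, E, ε)`. -/
structure BBProbSpace (B A : Type*) [Ring B] [Algebra ℂ B] [Ring A] [Algebra ℂ A] where
  ε : B ⊗[ℂ] Bᵐᵒᵖ →ₐ[ℂ] A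
  injective_left : Function.Injective fun b : B => ε (b ⊗ₜ[ℂ] 1)
  injective_right : Function.Injective fun b : Bᵐᵒᵖ => ε (1 ⊗ₜ[ℂ] b)
  E : A →ₗ[ℂ] B
  E_mul : ∀ (b₁ b₂ : B) (T : A),
    E (ε (b₁ ⊗ₜ[ℂ] MulOpposite.op b₂) * T) = b₁ * E T * b₂
  E_comm : ∀ (b : B) (T : A),
    E (T * ε (b ⊗ₜ[ℂ] 1)) = E (T * ε (1 ⊗ₜ[ℂ] MulOpposite.op b))

namespace BBProbSpace

variable {B A : Type*} [Ring B] [Algebra ℂ B] [Ring A] [Algebra ℂ A] (P : BBProbSpace B A)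

/-- `L_b = ε (b ⊗ 1)` on the left side and `R_b = ε (1 ⊗ b)` on the right side. -/
def op : Side → B → A
  | .left, b => P.ε (b ⊗ₜ[ℂ] 1)
  | .right, b => P.ε (1 ⊗ₜ[ℂ] MulOpposite.op b)

/-- The left algebra `A_ℓ` (all `T` commuting with every `R_b`) and the right algebra `A_r`
(all `T` commuting with every `L_b`). -/
def face : Side → Subalgebra ℂ A
  | .left => Subalgebra.centralizer ℂ (Set.range (P.op .right))
  | .right => Subalgebra.centralizer ℂ (Set.range (P.op .left))

theorem op_mem_face (s : Side) (b : B) : P.op s b ∈ P.face s := by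
  cases s <;>
  · simp only [face, Subalgebra.mem_centralizer_iff]
    rintro _ ⟨c, rfl⟩
    simp [op, ← map_mul]

/-- `L_b` as an element of `A_ℓ`, respectively `R_b` as an element of `A_r`. -/
def opFace (s : Side) (b : B) : P.face s := ⟨P.op s b, P.op_mem_face s b⟩

end BBProbSpace

/-! ### The order `≺_χ` and bi-non-crossing partitions -/

section Order

variable {n : ℕ} (χ : Fin n → Side)

/-- The place of `i` in the reading order of `χ`: first the left nodes in increasing order, then
the right nodes in decreasing order. Thus `a ≺_χ b` means `key χ a < key χ b`. -/
def key (i : Fin n) : Fin n ⊕ₗ (Fin n)ᵒᵈ :=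
  match χ i with
  | .left => Sum.inlₗ i
  | .right => Sum.inrₗ (OrderDual.toDual i)

/-- `a ≺_χ b`. -/
def Prec (a b : Fin n) : Prop := key χ a < key χ b

/-- `V` is an interval for `≺_χ`. -/
def IsChiInterval (V : Finset (Fin n)) : Prop :=
  ∀ a ∈ V, ∀ c ∈ V, ∀ b, Prec χ a b → Prec χ b c → b ∈ V

/-- `a = min_{≺_χ} S`. -/
def IsChiMin (S : Set (Fin n)) (a : Fin n) : Prop := a ∈ S ∧ ∀ b ∈ S, b ≠ a → Prec χ a b

/-- `a = max_{≺_χ} S`. -/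
def IsChiMax (S : Set (Fin n)) (a : Fin n) : Prop := a ∈ S ∧ ∀ b ∈ S, b ≠ a → Prec χ b a

/-- `BNC(χ)`: the partitions of the `n` nodes (given as equivalence relations) that are
bi-non-crossing with respect to `χ`. -/
@[ext]
structure BNC where
  rel : Setoid (Fin n)
  noncrossing : ∀ u₁ v₁ u₂ v₂, Prec χ u₁ v₁ → Prec χ v₁ u₂ → Prec χ u₂ v₂ →
    rel.r u₁ u₂ → rel.r v₁ v₂ → rel.r u₁ v₁

/-- The partition `1_χ` with a single block. -/
def BNC.one : BNC χ where
  rel := ⊤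
  noncrossing := fun _ _ _ _ _ _ _ _ _ => trivial

variable {χ}

/-- `S` is a union of blocks of `π`. -/
def BNC.IsUnionOfBlocks (π : BNC χ) (S : Finset (Fin n)) : Prop :=
  ∀ i j, π.rel.r i j → i ∈ S → j ∈ S

/-- The increasing enumeration of the elements of `S`, by which objects indexed by `S` are regarded
as `|S|`-tuples. -/
def enum (S : Finset (Fin n)) : Fin S.card → Fin n := S.orderEmbOfFin rfl

theorem prec_of_prec_enum {S : Finset (Fin n)} {a b : Fin S.card}
    (h : Prec (χ ∘ enum S) a b) : Prec χ (enum S a) (enum S b) := by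
  have hlt : ∀ {x y : Fin S.card}, x < y → enum S x < enum S y :=
    fun h => (S.orderEmbOfFin rfl).strictMono h
  revert h
  simp only [Prec, key, Function.comp]
  cases χ (enum S a) <;> cases χ (enum S b) <;> simp <;> exact hlt

/-- `π|_S`, the partition of `S` induced by `π`. -/
def BNC.restrict (π : BNC χ) (S : Finset (Fin n)) : BNC (χ ∘ enum S) where
  rel := Setoid.comap (enum S) π.rel
  noncrossing := fun _ _ _ _ h₁ h₂ h₃ r₁ r₂ =>
    π.noncrossing _ _ _ _ (prec_of_prec_enum h₁) (prec_of_prec_enum h₂) (prec_of_prec_enum h₃)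
      r₁ r₂

end Order

/-! ### The recursively defined expressions `E_π(T_1, …, T_n)` -/

section Recursion

open Classical in
/-- The nodes of `S` at which a block of `π|_S` terminates at the top, i.e. the minima of the
blocks. -/
def blockMinima {n : ℕ} (π : Setoid (Fin n)) (S : Finset (Fin n)) : Finset (Fin n) :=
  S.filter fun i => ∀ j ∈ S, π.r i j → i ≤ j

open Classical in
/-- The block of `π|_S` that contains `v`. -/
def blockOf {n : ℕ} (π : Setoid (Fin n)) (S : Finset (Fin n)) (v : Fin n) : Finset (Fin n) :=
  S.filter fun j => π.r v j

open Classical in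
/-- The nodes below `v` of the blocks of `π|_S` whose spine passes the height of `v`, that is, of
the blocks with nodes both above and below `v`. -/
def spineNodes {n : ℕ} (π : Setoid (Fin n)) (S : Finset (Fin n)) (v : Fin n) : Finset (Fin n) :=
  S.filter fun j => v < j ∧ ∃ i ∈ S, i < v ∧ π.r i j

theorem exists_blockMinima {n : ℕ} (π : Setoid (Fin n)) (S : Finset (Fin n)) {j : Fin n}
    (hj : j ∈ S) : ∃ m ∈ blockMinima π S, π.r m j := by
  classical
  have hne : (blockOf π S j).Nonempty := ⟨j, by simp [blockOf, hj]⟩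
  have hm := (blockOf π S j).min'_mem hne
  set m := (blockOf π S j).min' hne with hmdef
  have hm' : m ∈ S ∧ π.r j m := by simpa [blockOf] using hm
  refine ⟨m, ?_, π.iseqv.symm hm'.2⟩
  simp only [blockMinima, Finset.mem_filter]
  refine ⟨hm'.1, fun i hi hmi => Finset.min'_le _ _ ?_⟩
  simp [blockOf, hi, π.iseqv.trans hm'.2 hmi]

theorem blockMinima_nonempty {n : ℕ} (π : Setoid (Fin n)) {S : Finset (Fin n)}
    (hS : S.Nonempty) : (blockMinima π S).Nonempty :=
  hS.elim fun _ hj => (exists_blockMinima π S hj).elim fun m hm => ⟨m, hm.1⟩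

/-- `min V`, where `V` is the block of `π|_S` for which this minimum is largest. -/
def lowestStart {n : ℕ} (π : Setoid (Fin n)) (S : Finset (Fin n)) (hS : S.Nonempty) : Fin n :=
  (blockMinima π S).max' (blockMinima_nonempty π hS)

theorem lowestStart_mem {n : ℕ} (π : Setoid (Fin n)) (S : Finset (Fin n)) (hS : S.Nonempty) :
    lowestStart π S hS ∈ S := by
  classical
  exact (Finset.mem_filter.1 ((blockMinima π S).max'_mem (blockMinima_nonempty π hS))).1

theorem spineNodes_nonempty {n : ℕ} (π : Setoid (Fin n)) (S : Finset (Fin n)) (hS : S.Nonempty)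
    (h : ¬ ∀ j ∈ S, lowestStart π S hS < j → j ∈ blockOf π S (lowestStart π S hS)) :
    (spineNodes π S (lowestStart π S hS)).Nonempty := by
  classical
  push Not at h
  obtain ⟨j, hj, hlt, hnot⟩ := h
  obtain ⟨m, hm, hmj⟩ := exists_blockMinima π S hj
  refine ⟨j, ?_⟩
  simp only [spineNodes, Finset.mem_filter]
  refine ⟨hj, hlt, m, (Finset.mem_filter.1 hm).1, lt_of_le_of_ne (Finset.le_max' _ _ hm) ?_, hmj⟩
  rintro rfl
  exact hnot (by simpa [blockOf, hj] using hmj)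

/-- Given the nonempty set `N` of lower nodes of the spines passing a height, a node of the spine
that comes first when seen from side `s` at this height. The spines at one height are ordered from
left to right as their lower nodes are ordered by `≺_χ`, so this is the `≺_χ`-least node of `N` seen
from the left and the `≺_χ`-greatest one seen from the right. -/
def adjacentNode {n : ℕ} (χ : Fin n → Side) (N : Finset (Fin n)) (hN : N.Nonempty) :
    Side → Fin n
  | .left => (N.exists_min_image (key χ) hN).choose
  | .right => (N.exists_max_image (key χ) hN).choose

theorem adjacentNode_mem {n : ℕ} (χ : Fin n → Side) (N : Finset (Fin n)) (hN : N.Nonempty)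
    (s : Side) : adjacentNode χ N hN s ∈ N := by
  cases s
  · exact (N.exists_min_image (key χ) hN).choose_spec.1
  · exact (N.exists_max_image (key χ) hN).choose_spec.1

open Classical in
/-- The nodes of `S` below `v` that lie on the spine adjacent to `v`. -/
def belowOnAdjacent {n : ℕ} (χ : Fin n → Side) (π : Setoid (Fin n)) (S : Finset (Fin n))
    (v : Fin n) (hN : (spineNodes π S v).Nonempty) : Finset (Fin n) :=
  (blockOf π S (adjacentNode χ (spineNodes π S v) hN (χ v))).filter fun k => v < k

theorem belowOnAdjacent_nonempty {n : ℕ} (χ : Fin n → Side) (π : Setoid (Fin n))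
    (S : Finset (Fin n)) (v : Fin n) (hN : (spineNodes π S v).Nonempty) :
    (belowOnAdjacent χ π S v hN).Nonempty := by
  classical
  have h := Finset.mem_filter.1 (adjacentNode_mem χ (spineNodes π S v) hN (χ v))
  exact ⟨_, Finset.mem_filter.2 ⟨Finset.mem_filter.2 ⟨h.1, π.iseqv.refl _⟩, h.2.1⟩⟩

theorem sdiff_blockOf_nonempty {n : ℕ} (π : Setoid (Fin n)) (S : Finset (Fin n)) (v : Fin n)
    (h : ¬ ∀ i ∈ S, ∀ j ∈ S, π.r i j) : (S \ blockOf π S v).Nonempty := by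
  classical
  by_contra hne
  rw [Finset.not_nonempty_iff_eq_empty, Finset.sdiff_eq_empty_iff_subset] at hne
  refine h fun i hi j hj => ?_
  have hi' := (Finset.mem_filter.1 (hne hi)).2
  have hj' := (Finset.mem_filter.1 (hne hj)).2
  exact π.iseqv.trans (π.iseqv.symm hi') hj'

theorem nonempty_of_not_oneBlock {n : ℕ} (π : Setoid (Fin n)) (S : Finset (Fin n))
    (h : ¬ ∀ i ∈ S, ∀ j ∈ S, π.r i j) : S.Nonempty :=
  Finset.nonempty_iff_ne_empty.2 (by rintro rfl; simp at h)

theorem card_sdiff_blockOf_lt {n : ℕ} (π : Setoid (Fin n)) (S : Finset (Fin n)) (v : Fin n)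
    (hv : v ∈ S) : (S \ blockOf π S v).card < S.card := by
  classical
  refine Finset.card_lt_card (Finset.sdiff_ssubset (Finset.filter_subset _ _) ⟨v, ?_⟩)
  exact Finset.mem_filter.2 ⟨hv, π.iseqv.refl v⟩

/-- The product of the `T_i`, `i ∈ S`, in increasing order of `i`. -/
def orderedProd {A : Type*} [Ring A] {n : ℕ} (S : Finset (Fin n)) (T : Fin n → A) : A :=
  ((S.sort (· ≤ ·)).map T).prod

open Classical in
/-- `E_{π|_S}((T_1, …, T_n)|_S)` for a nonempty union `S` of blocks of `π`, with `T_i ∈ A` arbitrary.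
If `π|_S` has one block, this is the expectation of the ordered product. Otherwise let `V` be the
block whose minimum `v` is largest, and let `c` be `L_b` or `R_b`, according to the side of `v`,
with `b` the expectation of the ordered product over `V`. Then `V` is removed and `c` is inserted:
to the right of the last remaining operator if `V` consists of the last nodes of `S`, and otherwise
to the left of `T_k`, where `k` is the first node below `v` on the spine adjacent to `v`. -/
def momentOn {B A : Type*} [Ring B] [Algebra ℂ B] [Ring A] [Algebra ℂ A] (P : BBProbSpace B A)
    {n : ℕ} (χ : Fin n → Side) (π : Setoid (Fin n)) (S : Finset (Fin n)) (T : Fin n → A) : B :=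
  if h₁ : ∀ i ∈ S, ∀ j ∈ S, π.r i j then P.E (orderedProd S T)
  else
    have hS : S.Nonempty := nonempty_of_not_oneBlock π S h₁
    let v := lowestStart π S hS
    let V := blockOf π S v
    let c := P.op (χ v) (P.E (orderedProd V T))
    if h₂ : ∀ j ∈ S, v < j → j ∈ V then
      let k := (S \ V).max' (sdiff_blockOf_nonempty π S v h₁)
      momentOn P χ π (S \ V) (Function.update T k (T k * c))
    else
      let k := (belowOnAdjacent χ π S v (spineNodes_nonempty π S hS h₂)).min'
        (belowOnAdjacent_nonempty χ π S v _)
      momentOn P χ π (S \ V) (Function.update T k (c * T k))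
termination_by S.card
decreasing_by
  all_goals exact card_sdiff_blockOf_lt π S _ (lowestStart_mem π S hS)

/-- `E_π(T_1, …, T_n)`. -/
def recMoment {B A : Type*} [Ring B] [Algebra ℂ B] [Ring A] [Algebra ℂ A] (P : BBProbSpace B A)
    {n : ℕ} {χ : Fin n → Side} (π : BNC χ) (T : Fin n → A) : B :=
  momentOn P χ π.rel Finset.univ T

end Recursion

/-! ### Bi-multiplicative functions -/

section BiMultiplicative

variable {B A : Type*} [Ring B] [Algebra ℂ B] [Ring A] [Algebra ℂ A] (P : BBProbSpace B A)

/-- Tuples in `A_{χ(1)} × ⋯ × A_{χ(n)}`. -/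
abbrev Tuple {n : ℕ} (χ : Fin n → Side) : Type _ := (k : Fin n) → P.face (χ k)

/-- Functions on the disjoint union, over `n` and `χ`, of
`BNC(χ) × A_{χ(1)} × ⋯ × A_{χ(n)}`, with values in `B`. The value for `n = 0` is irrelevant. -/
abbrev PartitionFunction : Type _ :=
  ∀ ⦃n : ℕ⦄ (χ : Fin n → Side), BNC χ → Tuple P χ → B

variable {P}

/-- `(T_1, …, T_n)|_S`. -/
def Tuple.restrict {n : ℕ} {χ : Fin n → Side} (T : Tuple P χ) (S : Finset (Fin n)) :
    Tuple P (χ ∘ enum S) := fun k => T (enum S k)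

/-- Replaces `T_k` by `T_k L_b` if `χ(k) = ℓ` and by `T_k R_b` if `χ(k) = r`. -/
def Tuple.mulRight {n : ℕ} {χ : Fin n → Side} (T : Tuple P χ) (k : Fin n) (b : B) : Tuple P χ :=
  Function.update T k (T k * P.opFace (χ k) b)

/-- Replaces `T_k` by `L_b T_k` if `χ(k) = ℓ` and by `R_b T_k` if `χ(k) = r`. -/
def Tuple.mulLeft {n : ℕ} {χ : Fin n → Side} (T : Tuple P χ) (k : Fin n) (b : B) : Tuple P χ :=
  Function.update T k (P.opFace (χ k) b * T k)

/-- Property (i): moving a factor from the right of the last operator. -/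
def PropertyI (Φ : PartitionFunction P) : Prop :=
  ∀ (n : ℕ) (χ : Fin (n + 1) → Side) (T : Tuple P χ) (b : B),
    (∀ q, IsGreatest {k | χ k ≠ χ (Fin.last n)} q →
      Φ χ (BNC.one χ) (T.mulRight (Fin.last n) b) = Φ χ (BNC.one χ) (T.mulRight q b)) ∧
    ({k | χ k ≠ χ (Fin.last n)} = ∅ →
      (χ (Fin.last n) = .left →
        Φ χ (BNC.one χ) (T.mulRight (Fin.last n) b) = Φ χ (BNC.one χ) T * b) ∧
      (χ (Fin.last n) = .right →
        Φ χ (BNC.one χ) (T.mulRight (Fin.last n) b) = b * Φ χ (BNC.one χ) T))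

/-- Property (ii): moving a factor from the left of an operator. -/
def PropertyII (Φ : PartitionFunction P) : Prop :=
  ∀ (n : ℕ) (χ : Fin n → Side) (T : Tuple P χ) (b : B) (p : Fin n),
    (∀ q, IsGreatest {k | χ k = χ p ∧ k < p} q →
      Φ χ (BNC.one χ) (T.mulLeft p b) = Φ χ (BNC.one χ) (T.mulRight q b)) ∧
    ({k | χ k = χ p ∧ k < p} = ∅ →
      (χ p = .left → Φ χ (BNC.one χ) (T.mulLeft p b) = b * Φ χ (BNC.one χ) T) ∧
      (χ p = .right → Φ χ (BNC.one χ) (T.mulLeft p b) = Φ χ (BNC.one χ) T * b))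

/-- Property (iii): factorisation over `χ`-intervals. -/
def PropertyIII (Φ : PartitionFunction P) : Prop :=
  ∀ (n : ℕ) (χ : Fin n → Side) (T : Tuple P χ) (π : BNC χ), 0 < n →
    ∀ (m : ℕ) (V : Fin m → Finset (Fin n)),
      (∀ i, (V i).Nonempty) → (∀ i, IsChiInterval χ (V i)) → (∀ i, π.IsUnionOfBlocks (V i)) →
      (∀ k, ∃ i, k ∈ V i) → (∀ i j, i < j → ∀ a ∈ V i, ∀ b ∈ V j, Prec χ a b) →
      Φ χ π T =
        (List.ofFn fun i => Φ (χ ∘ enum (V i)) (π.restrict (V i)) (T.restrict (V i))).prod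

/-- Property (iv): nesting an inner `χ`-interval `V` into its complement `W`. -/
def PropertyIV (Φ : PartitionFunction P) : Prop :=
  ∀ (n : ℕ) (χ : Fin n → Side) (T : Tuple P χ) (π : BNC χ) (V W : Finset (Fin n)),
    IsCompl V W → π.IsUnionOfBlocks V → π.IsUnionOfBlocks W → IsChiInterval χ V →
    ∀ v₁ v₂ w₁ w₂ θ γ : Fin n,
      IsChiMin χ V v₁ → IsChiMax χ V v₂ →
      IsChiMin χ Set.univ w₁ → IsChiMax χ Set.univ w₂ → w₁ ∈ W → w₂ ∈ W →
      IsChiMax χ {k | k ∈ W ∧ Prec χ k v₁} θ →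
      IsChiMin χ {k | k ∈ W ∧ Prec χ v₂ k} γ →
      let x : B := Φ (χ ∘ enum V) (π.restrict V) (T.restrict V)
      let ΦW : Tuple P χ → B := fun T' => Φ (χ ∘ enum W) (π.restrict W) (T'.restrict W)
      (χ θ = .left → Φ χ π T = ΦW (T.mulRight θ x)) ∧
      (χ θ = .right → Φ χ π T = ΦW (T.mulLeft θ x)) ∧
      (χ γ = .left → Φ χ π T = ΦW (T.mulLeft γ x)) ∧
      (χ γ = .right → Φ χ π T = ΦW (T.mulRight γ x))

/-- `Φ` is linear in each of its operator arguments and has properties (i) to (iv). -/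
structure IsBiMultiplicative (Φ : PartitionFunction P) : Prop where
  map_add : ∀ (n : ℕ) (χ : Fin n → Side) (π : BNC χ) (T : Tuple P χ) (k : Fin n)
    (x y : P.face (χ k)), Φ χ π (Function.update T k (x + y)) =
      Φ χ π (Function.update T k x) + Φ χ π (Function.update T k y)
  map_smul : ∀ (n : ℕ) (χ : Fin n → Side) (π : BNC χ) (T : Tuple P χ) (k : Fin n)
    (a : ℂ) (x : P.face (χ k)), Φ χ π (Function.update T k (a • x)) =
      a • Φ χ π (Function.update T k x)
  property_i : PropertyI Φ
  property_ii : PropertyII Φ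
  property_iii : PropertyIII Φ
  property_iv : PropertyIV Φ

variable (P)

/-- The bi-free operator-valued moment function `𝓔_π(T_1, …, T_n) = E_π(T_1, …, T_n)`. -/
def momentFunction : PartitionFunction P := fun _ _ π T => recMoment P π fun k => (T k : A)

end BiMultiplicative

end BiFree

end

/-! Read the nodes along `≺_χ`: down the left side, then up the right side. An element of `B` can be
put into any gap between neighbouring nodes, or at either end. Everything rests on one fact: the
value depends only on the gap, not on which of its two ends carries the element.

For one block this is a sliding argument. `L_b` placed after a left operator commutes with right
operators, so it slides down to the next left operator. If there is none it reaches the right end of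
the product, where `E (T L_b) = E (T R_b)` turns it into `R_b`, which slides up past left operators
to the nearest right operator. If it reaches the left end of the product, `E (L_b T) = b E(T)` or `E
(R_b T) = E(T) b` takes it out. This is `blockValue_after_eq_before`, and it contains (i) and (ii).
Outer factors `l`, `r` in a `State` put the two ends of `≺_χ` on the same footing as the nodes.

For several blocks, let `V` be the block whose minimum `v` is largest. All other blocks start above
`v`, so non-crossing forces `V` to be an interval of the remaining nodes. Both forms of the
recursion put the value of `V` into the gap that `V` leaves (`stateMoment_eq_after_of_isLowest`),
although the definition may place it elsewhere on the adjacent spine. Moving it to the gap uses two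
facts: below a height above which every block starts, only the products over the blocks matter
(`momentOn_congr_below`), and `L_b`, `R_b` agree to the right of the last operator
(`momentOn_update_mul_op`).

Induction on the number of nodes then gives independence of the end of the gap for all non-crossing
partitions (`balanced`). A second induction, removing the lowest block from both sides, shows that
any interval which is a union of blocks may be replaced by its value in its gap
(`stateMoment_remove`). Removing intervals at the beginning of `≺_χ` gives (iii), and removing one
between `θ` and `γ` gives (iv). Linearity is a separate induction along the recursion. -/

noncomputable section

namespace BiFree

/-! ### Ordered products over sets of nodes, split at a height -/

section OrderedProd

variable {A : Type*} [Ring A] {n : ℕ}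

theorem orderedProd_union {S₁ S₂ : Finset (Fin n)} (h : ∀ a ∈ S₁, ∀ b ∈ S₂, a < b)
    (T : Fin n → A) : orderedProd (S₁ ∪ S₂) T = orderedProd S₁ T * orderedProd S₂ T := by
  have hd : Disjoint S₁ S₂ :=
    Finset.disjoint_left.2 fun a h₁ h₂ => lt_irrefl _ (h a h₁ a h₂)
  have hs : (S₁ ∪ S₂).sort (· ≤ ·) = S₁.sort (· ≤ ·) ++ S₂.sort (· ≤ ·) := by
    refine List.Perm.eq_of_pairwise' (Finset.pairwise_sort _ _) ?_ ?_
    · refine List.pairwise_append.2 ⟨Finset.pairwise_sort _ _, Finset.pairwise_sort _ _, ?_⟩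
      intro a ha b hb
      exact (h a ((Finset.mem_sort _).1 ha) b ((Finset.mem_sort _).1 hb)).le
    · rw [← Multiset.coe_eq_coe, ← Multiset.coe_add, Finset.sort_eq, Finset.sort_eq,
        Finset.sort_eq, ← Finset.disjUnion_eq_union _ _ hd]
      rfl
  simp [orderedProd, hs]

@[simp]
theorem orderedProd_empty (T : Fin n → A) : orderedProd ∅ T = 1 := by simp [orderedProd]

@[simp]
theorem orderedProd_singleton (a : Fin n) (T : Fin n → A) : orderedProd {a} T = T a := by
  simp [orderedProd]

theorem orderedProd_congr {S : Finset (Fin n)} {T T' : Fin n → A} (h : ∀ k ∈ S, T k = T' k) :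
    orderedProd S T = orderedProd S T' := by
  unfold orderedProd
  congr 1
  exact List.map_congr_left fun k hk => h k ((Finset.mem_sort _).1 hk)

theorem orderedProd_map {m : ℕ} (e : Fin m ↪o Fin n) (S : Finset (Fin m)) (T : Fin n → A) :
    orderedProd (S.map e.toEmbedding) T = orderedProd S (T ∘ e) := by
  unfold orderedProd
  rw [← Finset.map_sort e.toEmbedding S (· ≤ ·) (· ≤ ·) (fun a _ b _ => by simp), List.map_map]
  rfl

/-- The part of the ordered product over `S` with indices less than `h`. -/
def prodBelow (S : Finset (Fin n)) (h : ℕ) (T : Fin n → A) : A :=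
  orderedProd (S.filter fun i => i.val < h) T

/-- The part of the ordered product over `S` with indices at least `h`. -/
def prodFrom (S : Finset (Fin n)) (h : ℕ) (T : Fin n → A) : A :=
  orderedProd (S.filter fun i => h ≤ i.val) T

theorem prodBelow_mul_prodFrom (S : Finset (Fin n)) (h : ℕ) (T : Fin n → A) :
    prodBelow S h T * prodFrom S h T = orderedProd S T := by
  unfold prodBelow prodFrom
  rw [← orderedProd_union]
  · congr 1
    ext i
    simp only [Finset.mem_union, Finset.mem_filter]
    have := lt_or_ge i.val h
    tauto
  · intro a ha b hb
    have h₁ := (Finset.mem_filter.1 ha).2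
    have h₂ := (Finset.mem_filter.1 hb).2
    exact Fin.lt_def.2 (by omega)

theorem prodBelow_congr {S : Finset (Fin n)} {h : ℕ} {T T' : Fin n → A}
    (hT : ∀ k ∈ S, k.val < h → T k = T' k) : prodBelow S h T = prodBelow S h T' :=
  orderedProd_congr fun k hk => hT k (Finset.mem_filter.1 hk).1 (Finset.mem_filter.1 hk).2

theorem prodFrom_congr {S : Finset (Fin n)} {h : ℕ} {T T' : Fin n → A}
    (hT : ∀ k ∈ S, h ≤ k.val → T k = T' k) : prodFrom S h T = prodFrom S h T' :=
  orderedProd_congr fun k hk => hT k (Finset.mem_filter.1 hk).1 (Finset.mem_filter.1 hk).2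

theorem prodBelow_succ_of_mem {S : Finset (Fin n)} {a : Fin n} (ha : a ∈ S) (T : Fin n → A) :
    prodBelow S (a.val + 1) T = prodBelow S a.val T * T a := by
  unfold prodBelow
  rw [← orderedProd_singleton a T, ← orderedProd_union]
  · congr 1
    ext i
    simp only [Finset.mem_union, Finset.mem_filter, Finset.mem_singleton]
    constructor
    · rintro ⟨hi, h⟩
      rcases Nat.lt_succ_iff_lt_or_eq.1 h with h | h
      · exact Or.inl ⟨hi, h⟩
      · exact Or.inr (Fin.ext h)
    · rintro (⟨hi, h⟩ | rfl)
      · exact ⟨hi, by omega⟩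
      · exact ⟨ha, by omega⟩
  · intro i hi j hj
    rw [Finset.mem_singleton.1 hj]
    exact Fin.lt_def.2 (Finset.mem_filter.1 hi).2

theorem prodFrom_of_mem {S : Finset (Fin n)} {a : Fin n} (ha : a ∈ S) (T : Fin n → A) :
    prodFrom S a.val T = T a * prodFrom S (a.val + 1) T := by
  unfold prodFrom
  rw [← orderedProd_singleton a T, ← orderedProd_union]
  · congr 1
    ext i
    simp only [Finset.mem_union, Finset.mem_filter, Finset.mem_singleton]
    constructor
    · rintro ⟨hi, h⟩
      rcases Nat.lt_or_eq_of_le h with h | h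
      · exact Or.inr ⟨hi, h⟩
      · exact Or.inl (Fin.ext h.symm)
    · rintro (rfl | ⟨hi, h⟩)
      · exact ⟨ha, le_rfl⟩
      · exact ⟨hi, by omega⟩
  · intro i hi j hj
    rw [Finset.mem_singleton.1 hi]
    exact Fin.lt_def.2 (Finset.mem_filter.1 hj).2

theorem filter_lt_succ_of_forall_ne {S : Finset (Fin n)} {h : ℕ} (hh : ∀ i ∈ S, i.val ≠ h) :
    (S.filter fun i => i.val < h + 1) = S.filter fun i => i.val < h :=
  Finset.filter_congr fun i hi => by have := hh i hi; omega

theorem filter_le_of_forall_ne {S : Finset (Fin n)} {h : ℕ} (hh : ∀ i ∈ S, i.val ≠ h) :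
    (S.filter fun i => h ≤ i.val) = S.filter fun i => h + 1 ≤ i.val :=
  Finset.filter_congr fun i hi => by have := hh i hi; omega

theorem prodBelow_of_le {S : Finset (Fin n)} {h : ℕ} (hh : ∀ i ∈ S, i.val < h) (T : Fin n → A) :
    prodBelow S h T = orderedProd S T := by
  rw [prodBelow, Finset.filter_true_of_mem hh]

theorem prodFrom_zero (S : Finset (Fin n)) (T : Fin n → A) :
    prodFrom S 0 T = orderedProd S T := by
  simp [prodFrom]

theorem prodFrom_of_lt {S : Finset (Fin n)} {h : ℕ} (hh : ∀ i ∈ S, i.val < h) (T : Fin n → A) :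
    prodFrom S h T = 1 := by
  rw [prodFrom, Finset.filter_false_of_mem fun i hi => not_le.2 (hh i hi), orderedProd_empty]

theorem prodBelow_zero (S : Finset (Fin n)) (T : Fin n → A) : prodBelow S 0 T = 1 := by
  simp [prodBelow]

theorem orderedProd_eq_mul_mul {S : Finset (Fin n)} {a : Fin n} (ha : a ∈ S) (T : Fin n → A) :
    orderedProd S T = prodBelow S a.val T * T a * prodFrom S (a.val + 1) T := by
  rw [← prodBelow_mul_prodFrom S a.val T, prodFrom_of_mem ha, mul_assoc]

theorem orderedProd_update {S : Finset (Fin n)} {a : Fin n} (ha : a ∈ S) (T : Fin n → A) (y : A) :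
    orderedProd S (Function.update T a y) =
      prodBelow S a.val T * y * prodFrom S (a.val + 1) T := by
  rw [orderedProd_eq_mul_mul ha, Function.update_self]
  congr 1
  · congr 1
    exact prodBelow_congr fun k _ hk => Function.update_of_ne (by rintro rfl; omega) _ _
  · exact prodFrom_congr fun k _ hk => Function.update_of_ne (by rintro rfl; omega) _ _

theorem orderedProd_update_of_notMem {S : Finset (Fin n)} {a : Fin n} (ha : a ∉ S)
    (T : Fin n → A) (y : A) : orderedProd S (Function.update T a y) = orderedProd S T :=
  orderedProd_congr fun k hk => Function.update_of_ne (by rintro rfl; exact ha hk) _ _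

theorem prodFrom_update_mul {V : Finset (Fin n)} {k : Fin n} {h : ℕ} (hk : k ∈ V) (hhk : h ≤ k.val)
    (hfirst : ∀ i ∈ V, h ≤ i.val → k ≤ i) (T : Fin n → A) (c : A) :
    prodFrom V h (Function.update T k (c * T k)) = c * prodFrom V h T := by
  have hf : ∀ T : Fin n → A, prodFrom V h T = prodFrom V k.val T := fun T => by
    unfold prodFrom
    rw [Finset.filter_congr fun i hi => ⟨fun hh => Fin.le_def.1 (hfirst i hi hh), hhk.trans⟩]
  rw [hf, hf, prodFrom_of_mem hk, prodFrom_of_mem hk, Function.update_self, mul_assoc,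
    prodFrom_congr (T' := T) fun j _ hj => Function.update_of_ne (by rintro rfl; omega) _ _]

end OrderedProd

/-! ### Positions -/

section Position

variable {n : ℕ} (χ : Fin n → Side)

/-- The rank of a node among `2 n` places: the left node `i` has place `i`, the right node `i`
has place `2 n - 1 - i`. -/
def pos (i : Fin n) : ℕ :=
  match χ i with
  | .left => i.val
  | .right => 2 * n - 1 - i.val

variable {χ}

theorem pos_left {i : Fin n} (h : χ i = .left) : pos χ i = i.val := by simp [pos, h]

theorem pos_right {i : Fin n} (h : χ i = .right) : pos χ i = 2 * n - 1 - i.val := by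
  simp [pos, h]

theorem Side.left_or_right (s : Side) : s = .left ∨ s = .right := by cases s <;> simp

theorem pos_cases (χ : Fin n → Side) (i : Fin n) :
    (χ i = .left ∧ pos χ i = i.val ∧ i.val < n) ∨
      (χ i = .right ∧ pos χ i = 2 * n - 1 - i.val ∧ i.val < n) := by
  rcases (χ i).left_or_right with h | h
  · exact Or.inl ⟨h, pos_left h, i.isLt⟩
  · exact Or.inr ⟨h, pos_right h, i.isLt⟩

theorem key_lt_iff {a b : Fin n} : key χ a < key χ b ↔ pos χ a < pos χ b := by
  have ha := a.isLt
  have hb := b.isLt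
  simp only [key, pos]
  cases χ a <;> cases χ b <;> simp <;> omega

theorem prec_iff {a b : Fin n} : Prec χ a b ↔ pos χ a < pos χ b := key_lt_iff

theorem pos_injective : Function.Injective (pos χ) := by
  intro a b h
  apply Fin.ext
  rcases pos_cases χ a with h₁ | h₁ <;> rcases pos_cases χ b with h₂ | h₂ <;> omega

end Position

/-! ### Inserting an element of `B` into an ordered product -/

namespace BBProbSpace

variable {B A : Type*} [Ring B] [Algebra ℂ B] [Ring A] [Algebra ℂ A] (P : BBProbSpace B A)

theorem op_left_mul (b b' : B) : P.op .left b * P.op .left b' = P.op .left (b * b') := by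
  simp [op, ← map_mul]

theorem op_right_mul (b b' : B) : P.op .right b * P.op .right b' = P.op .right (b' * b) := by
  simp [op, ← map_mul]

theorem E_left_mul (b : B) (T : A) : P.E (P.op .left b * T) = b * P.E T := by
  simpa [op] using P.E_mul b 1 T

theorem E_right_mul (b : B) (T : A) : P.E (P.op .right b * T) = P.E T * b := by
  simpa [op] using P.E_mul 1 b T

theorem E_mul_op (b : B) (T : A) (s s' : Side) : P.E (T * P.op s b) = P.E (T * P.op s' b) := by
  have := P.E_comm b T
  cases s <;> cases s' <;> simp_all [op]

theorem commute_op_of_mem {s s' : Side} (hs : s ≠ s') {T : A} (hT : T ∈ P.face s) (b : B) :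
    Commute (P.op s' b) T := by
  cases s <;> cases s' <;> first | exact absurd rfl hs | skip
  · exact (Subalgebra.mem_centralizer_iff ℂ).1 hT _ ⟨b, rfl⟩
  · exact (Subalgebra.mem_centralizer_iff ℂ).1 hT _ ⟨b, rfl⟩

variable {n : ℕ}

/-- The ordered product over `S` with `L_b` or `R_b` inserted before the index `h`. -/
def cut (S : Finset (Fin n)) (T : Fin n → A) (s : Side) (h : ℕ) (b : B) : A :=
  prodBelow S h T * P.op s b * prodFrom S h T

/-- If `S` has a node at height `h`, its operator lies in the face opposite to `s` and so commutes
with the inserted element; otherwise both cuts split the product in the same way. -/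
theorem cut_succ {χ : Fin n → Side} {S : Finset (Fin n)} {T : Fin n → A}
    (hT : ∀ k, T k ∈ P.face (χ k)) (s : Side) {h : ℕ} (b : B)
    (hh : ∀ i ∈ S, i.val = h → χ i ≠ s) : P.cut S T s h b = P.cut S T s (h + 1) b := by
  unfold cut
  by_cases hi : ∃ i ∈ S, i.val = h
  · obtain ⟨i, hi, rfl⟩ := hi
    rw [prodBelow_succ_of_mem hi, prodFrom_of_mem hi, mul_assoc, ← mul_assoc (P.op s b),
      (P.commute_op_of_mem (hh i hi rfl) (hT i) b).eq]
    simp only [mul_assoc]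
  · push Not at hi
    rw [prodBelow, prodFrom, filter_le_of_forall_ne hi, ← filter_lt_succ_of_forall_ne hi]
    rfl

theorem cut_eq {χ : Fin n → Side} {S : Finset (Fin n)} {T : Fin n → A}
    (hT : ∀ k, T k ∈ P.face (χ k)) (s : Side) {h h' : ℕ} (b : B) (hle : h ≤ h')
    (hh : ∀ i ∈ S, h ≤ i.val → i.val < h' → χ i ≠ s) : P.cut S T s h b = P.cut S T s h' b := by
  induction h', hle using Nat.le_induction with
  | base => rfl
  | succ q hq ih =>
    rw [ih fun i hi h₁ h₂ => hh i hi h₁ (by omega)]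
    exact P.cut_succ hT s b fun i hi h => hh i hi (by omega) (by omega)

theorem cut_zero (S : Finset (Fin n)) (T : Fin n → A) (s : Side) (b : B) :
    P.cut S T s 0 b = P.op s b * orderedProd S T := by
  rw [cut, prodBelow_zero, prodFrom_zero, one_mul]

theorem cut_top (S : Finset (Fin n)) (T : Fin n → A) (s : Side) (b : B) :
    P.cut S T s n b = orderedProd S T * P.op s b := by
  rw [cut, prodBelow_of_le fun i _ => i.isLt, prodFrom_of_lt fun i _ => i.isLt, mul_one]

/-- The inserted factor slides up from `a` to the height `h`, past operators of the opposite side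
only. This and the next lemma carry an insertion along the adjacent spine; in the next one the
factor starts to the right of `T a`, so `a` itself must also be on the opposite side. -/
theorem prodFrom_update_op_mul {χ : Fin n → Side} {V : Finset (Fin n)} {T : Fin n → A}
    (hT : ∀ k, T k ∈ P.face (χ k)) {a : Fin n} {h : ℕ} (ha : a ∈ V) (hha : h ≤ a.val) (s : Side)
    (b : B) (hs : ∀ i ∈ V, h ≤ i.val → i < a → χ i ≠ s) :
    prodFrom V h (Function.update T a (P.op s b * T a)) = P.op s b * prodFrom V h T := by
  have ha' : a ∈ V.filter fun i => h ≤ i.val := Finset.mem_filter.2 ⟨ha, hha⟩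
  rw [prodFrom, prodFrom, orderedProd_update ha', ← P.cut_zero, P.cut_eq hT s b a.val.zero_le, cut,
    prodFrom_of_mem ha']
  · simp only [mul_assoc]
  · exact fun i hi _ hlt => hs i (Finset.mem_filter.1 hi).1 (Finset.mem_filter.1 hi).2 hlt

theorem prodFrom_update_mul_op {χ : Fin n → Side} {V : Finset (Fin n)} {T : Fin n → A}
    (hT : ∀ k, T k ∈ P.face (χ k)) {a : Fin n} {h : ℕ} (ha : a ∈ V) (hha : h ≤ a.val) (s : Side)
    (b : B) (hs : ∀ i ∈ V, h ≤ i.val → i ≤ a → χ i ≠ s) :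
    prodFrom V h (Function.update T a (T a * P.op s b)) = P.op s b * prodFrom V h T := by
  have ha' : a ∈ V.filter fun i => h ≤ i.val := Finset.mem_filter.2 ⟨ha, hha⟩
  rw [prodFrom, prodFrom, orderedProd_update ha', ← P.cut_zero,
    P.cut_eq hT s b (a.val + 1).zero_le, cut, prodBelow_succ_of_mem ha']
  · simp only [mul_assoc]
  · exact fun i hi _ hlt => hs i (Finset.mem_filter.1 hi).1 (Finset.mem_filter.1 hi).2
      (Nat.lt_succ_iff.1 hlt)

/-- The expectation of the ordered product over `S` with `b` inserted at one of the places
`0, …, 2 n`, numbered along `≺_χ`. -/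
def cutMoment (S : Finset (Fin n)) (T : Fin n → A) (p : ℕ) (b : B) : B :=
  if p ≤ n then P.E (P.cut S T .left p b) else P.E (P.cut S T .right (2 * n - p) b)

theorem cutMoment_left (S : Finset (Fin n)) (T : Fin n → A) {p : ℕ} (b : B) (hp : p ≤ n) :
    P.cutMoment S T p b = P.E (P.cut S T .left p b) := if_pos hp

/-- The only overlap with the left form is `p = n`, where the cut is at the right end of the product
and `E` does not distinguish `L_b` from `R_b`. This is where an element passes from the left side to
the right side. -/
theorem cutMoment_right (S : Finset (Fin n)) (T : Fin n → A) {p : ℕ} (b : B) (hp : n ≤ p) :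
    P.cutMoment S T p b = P.E (P.cut S T .right (2 * n - p) b) := by
  rcases hp.eq_or_lt with rfl | hp
  · rw [P.cutMoment_left S T b le_rfl, show 2 * n - n = n by omega, cut_top, cut_top,
      P.E_mul_op b _ .left .right]
  · exact if_neg (by omega)

theorem cutMoment_zero (S : Finset (Fin n)) (T : Fin n → A) (b : B) :
    P.cutMoment S T 0 b = b * P.E (orderedProd S T) := by
  rw [cutMoment_left _ _ _ _ (Nat.zero_le _), cut_zero, E_left_mul]

theorem cutMoment_top (S : Finset (Fin n)) (T : Fin n → A) (b : B) :
    P.cutMoment S T (2 * n) b = P.E (orderedProd S T) * b := by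
  rw [cutMoment_right _ _ _ _ (by omega), Nat.sub_self, cut_zero, E_right_mul]

/-- The only obstruction to passing from place `p` to place `p + 1` is a node of position `p`: for
`p < n` a left node of index `p`, otherwise a right node of index `2 n - 1 - p`. A node of that
index on the other side commutes with the inserted element. -/
theorem cutMoment_succ {χ : Fin n → Side} {S : Finset (Fin n)} {T : Fin n → A}
    (hT : ∀ k, T k ∈ P.face (χ k)) {p : ℕ} (b : B) (hp : p < 2 * n)
    (hh : ∀ i ∈ S, pos χ i ≠ p) : P.cutMoment S T p b = P.cutMoment S T (p + 1) b := by
  rcases Nat.lt_or_ge p n with h | h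
  · rw [cutMoment_left _ _ _ _ h.le, cutMoment_left _ _ _ _ h, P.cut_succ hT]
    rintro i hi rfl hs
    exact hh i hi (pos_left hs)
  · rw [cutMoment_right _ _ _ _ h, cutMoment_right _ _ _ _ (by omega),
      show 2 * n - p = (2 * n - (p + 1)) + 1 by omega, ← P.cut_succ hT]
    intro i hi hip hs
    exact hh i hi (by rw [pos_right hs]; omega)

theorem cutMoment_eq {χ : Fin n → Side} {S : Finset (Fin n)} {T : Fin n → A}
    (hT : ∀ k, T k ∈ P.face (χ k)) {p q : ℕ} (b : B) (hpq : p ≤ q) (hq : q ≤ 2 * n)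
    (hh : ∀ i ∈ S, pos χ i < p ∨ q ≤ pos χ i) :
    P.cutMoment S T p b = P.cutMoment S T q b := by
  induction q, hpq using Nat.le_induction with
  | base => rfl
  | succ q hpq ih =>
    rw [ih (by omega) fun i hi => by have := hh i hi; omega]
    exact P.cutMoment_succ hT b (by omega) fun i hi => by have := hh i hi; omega

end BBProbSpace

/-! ### Sites and states -/

/-- A place to which an element of `B` can be attached: a node, or one of the two ends of `≺_χ`. -/
inductive Site (n : ℕ)
  | bot
  | node (i : Fin n)
  | top

/-- The rank of a site along `≺_χ`. -/
def Site.rank {n : ℕ} (χ : Fin n → Side) : Site n → ℕ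
  | .bot => 0
  | .node i => pos χ i + 1
  | .top => 2 * n + 1

/-- The sites of `S` are its nodes and the two ends. -/
def Site.IsIn {n : ℕ} (S : Finset (Fin n)) : Site n → Prop
  | .bot => True
  | .node i => i ∈ S
  | .top => True

@[simp] theorem Site.rank_bot {n : ℕ} (χ : Fin n → Side) : Site.rank χ .bot = 0 := rfl
@[simp] theorem Site.rank_node {n : ℕ} (χ : Fin n → Side) (i : Fin n) :
    Site.rank χ (.node i) = pos χ i + 1 := rfl
@[simp] theorem Site.rank_top {n : ℕ} (χ : Fin n → Side) : Site.rank χ .top = 2 * n + 1 := rfl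

theorem pos_lt {n : ℕ} (χ : Fin n → Side) (i : Fin n) : pos χ i < 2 * n := by
  rcases pos_cases χ i with h | h <;> omega

theorem Site.rank_injective {n : ℕ} {χ : Fin n → Side} {a c : Site n}
    (h : a.rank χ = c.rank χ) : a = c := by
  cases a with
  | bot => cases c with
    | bot => rfl
    | node j => simp at h
    | top => simp at h
  | node i =>
    have hi := pos_lt χ i
    cases c with
    | bot => simp at h
    | node j => simp only [Site.rank_node, Nat.add_right_cancel_iff] at h; rw [pos_injective h]
    | top => simp at h; omega
  | top => cases c with
    | bot => simp at h
    | node j => have hj := pos_lt χ j; simp at h; omega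
    | top => rfl

/-- `a` and `c` are sites of `S` that follow each other along `≺_χ`. -/
structure Consecutive {n : ℕ} (χ : Fin n → Side) (S : Finset (Fin n)) (a c : Site n) : Prop where
  left_isIn : a.IsIn S
  right_isIn : c.IsIn S
  lt : a.rank χ < c.rank χ
  not_between : ∀ k ∈ S, pos χ k + 1 ≤ a.rank χ ∨ c.rank χ ≤ pos χ k + 1

/-- A tuple of operators together with a left and a right factor in `B`. -/
structure State (B A : Type*) (n : ℕ) where
  l : B
  r : B
  T : Fin n → A

section State

variable {B A : Type*} [Ring B] [Algebra ℂ B] [Ring A] [Algebra ℂ A] (P : BBProbSpace B A)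
  {n : ℕ} (χ : Fin n → Side)

/-- The operator `T` with `b` attached on the side of `s` that follows along `≺_χ`. -/
def mulAfter : Side → A → B → A
  | .left, T, b => T * P.op .left b
  | .right, T, b => P.op .right b * T

/-- The operator `T` with `b` attached on the side of `s` that precedes along `≺_χ`. -/
def mulBefore : Side → A → B → A
  | .left, T, b => P.op .left b * T
  | .right, T, b => T * P.op .right b

/-- Inserts `b` immediately after the site `a`. -/
def State.after (X : State B A n) : Site n → B → State B A n
  | .bot, b => ⟨X.l * b, X.r, X.T⟩
  | .node i, b => ⟨X.l, X.r, Function.update X.T i (mulAfter P (χ i) (X.T i) b)⟩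
  -- Nothing follows the upper end. The value is a default, never reached from the left site of a
  -- consecutive pair; likewise for `bot` in `State.before`.
  | .top, _ => X

/-- Inserts `b` immediately before the site `c`. -/
def State.before (X : State B A n) : Site n → B → State B A n
  | .bot, _ => X
  | .node i, b => ⟨X.l, X.r, Function.update X.T i (mulBefore P (χ i) (X.T i) b)⟩
  | .top, b => ⟨X.l, b * X.r, X.T⟩

/-- All operators of the state belong to the algebra of their side. -/
def State.Adapted (X : State B A n) : Prop := ∀ k, X.T k ∈ P.face (χ k)

variable {P χ}

theorem mulAfter_mem {s : Side} {T : A} (hT : T ∈ P.face s) (b : B) :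
    mulAfter P s T b ∈ P.face s := by
  cases s
  · exact mul_mem hT (P.op_mem_face _ b)
  · exact mul_mem (P.op_mem_face _ b) hT

theorem mulBefore_mem {s : Side} {T : A} (hT : T ∈ P.face s) (b : B) :
    mulBefore P s T b ∈ P.face s := by
  cases s
  · exact mul_mem (P.op_mem_face _ b) hT
  · exact mul_mem hT (P.op_mem_face _ b)

theorem mulAfter_mulAfter (s : Side) (T : A) (b b' : B) :
    mulAfter P s (mulAfter P s T b) b' = mulAfter P s T (b * b') := by
  cases s
  · simp only [mulAfter, mul_assoc, P.op_left_mul]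
  · simp only [mulAfter, ← mul_assoc, P.op_right_mul]

theorem mulBefore_mulBefore (s : Side) (T : A) (b b' : B) :
    mulBefore P s (mulBefore P s T b) b' = mulBefore P s T (b' * b) := by
  cases s
  · simp only [mulBefore, ← mul_assoc, P.op_left_mul]
  · simp only [mulBefore, mul_assoc, P.op_right_mul]

theorem State.Adapted.after {X : State B A n} (hX : X.Adapted P χ) (a : Site n) (b : B) :
    (X.after P χ a b).Adapted P χ := by
  cases a with
  | bot => exact hX
  | node i =>
    intro k
    simp only [State.after]
    rcases eq_or_ne k i with rfl | h
    · rw [Function.update_self]; exact mulAfter_mem (hX k) b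
    · rw [Function.update_of_ne h]; exact hX k
  | top => exact hX

theorem State.Adapted.before {X : State B A n} (hX : X.Adapted P χ) (a : Site n) (b : B) :
    (X.before P χ a b).Adapted P χ := by
  cases a with
  | bot => exact hX
  | node i =>
    intro k
    simp only [State.before]
    rcases eq_or_ne k i with rfl | h
    · rw [Function.update_self]; exact mulBefore_mem (hX k) b
    · rw [Function.update_of_ne h]; exact hX k
  | top => exact hX

/-- An element attached earlier counts as part of the operator, so the new one lands further away
from the site: to the right of the old one here, to its left for `before`. On the right side the
reversed product of the `R_b` gives the same order. -/
theorem State.after_after (X : State B A n) (a : Site n) (b b' : B) :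
    (X.after P χ a b).after P χ a b' = X.after P χ a (b * b') := by
  cases a <;> simp [State.after, mul_assoc, mulAfter_mulAfter]

theorem State.before_before (X : State B A n) (a : Site n) (b b' : B) :
    (X.before P χ a b).before P χ a b' = X.before P χ a (b' * b) := by
  cases a <;> simp [State.before, mul_assoc, mulBefore_mulBefore]

theorem State.after_comm (X : State B A n) {a a' : Site n} (h : a ≠ a') (b b' : B) :
    (X.after P χ a b).after P χ a' b' = (X.after P χ a' b').after P χ a b := by
  cases a <;> cases a' <;> first | exact absurd rfl h | rfl | skip
  rename_i i j
  have hij : i ≠ j := fun e => h (e ▸ rfl)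
  simp only [State.after, Function.update_of_ne hij, Function.update_of_ne hij.symm]
  rw [Function.update_comm hij]

theorem State.before_comm (X : State B A n) {a a' : Site n} (h : a ≠ a') (b b' : B) :
    (X.before P χ a b).before P χ a' b' = (X.before P χ a' b').before P χ a b := by
  cases a <;> cases a' <;> first | exact absurd rfl h | rfl | skip
  rename_i i j
  have hij : i ≠ j := fun e => h (e ▸ rfl)
  simp only [State.before, Function.update_of_ne hij, Function.update_of_ne hij.symm]
  rw [Function.update_comm hij]

theorem State.after_before_comm (X : State B A n) {a a' : Site n} (h : a ≠ a') (b b' : B) :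
    (X.after P χ a b).before P χ a' b' = (X.before P χ a' b').after P χ a b := by
  cases a <;> cases a' <;> first | exact absurd rfl h | rfl | skip
  rename_i i j
  have hij : i ≠ j := fun e => h (e ▸ rfl)
  simp only [State.before, State.after, Function.update_of_ne hij, Function.update_of_ne hij.symm]
  rw [Function.update_comm hij]

theorem State.after_T_of_ne (X : State B A n) {a : Site n} {k : Fin n} (h : a ≠ .node k) (b : B) :
    (X.after P χ a b).T k = X.T k := by
  cases a with
  | bot => rfl
  | node i => exact Function.update_of_ne (fun e => h (congrArg Site.node e.symm)) _ _
  | top => rfl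

theorem State.before_T_of_ne (X : State B A n) {a : Site n} {k : Fin n} (h : a ≠ .node k) (b : B) :
    (X.before P χ a b).T k = X.T k := by
  cases a with
  | bot => rfl
  | node i => exact Function.update_of_ne (fun e => h (congrArg Site.node e.symm)) _ _
  | top => rfl

end State

/-! ### One block -/

section OneBlock

variable {B A : Type*} [Ring B] [Algebra ℂ B] [Ring A] [Algebra ℂ A] {P : BBProbSpace B A}
  {n : ℕ} {χ : Fin n → Side}

variable (P) in
/-- The value of a state on a single block. -/
def blockValue (V : Finset (Fin n)) (X : State B A n) : B := X.l * P.E (orderedProd V X.T) * X.r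

/-- A node of position `p` sits between the places `p` and `p + 1` of `cutMoment` and has rank `p +
1`. Hence "after" a site of rank `r` is the place `r`, and "before" it is the place `r - 1`; the
ends fit the same rule. -/
theorem blockValue_after {V : Finset (Fin n)} (X : State B A n) {a : Site n} (ha : a.IsIn V)
    (hat : a.rank χ ≤ 2 * n) (b : B) : blockValue P V (X.after P χ a b) =
      X.l * P.cutMoment V X.T (a.rank χ) b * X.r := by
  cases a with
  | bot => simp [blockValue, State.after, P.cutMoment_zero, mul_assoc]
  | node i =>
    have hi := i.isLt
    simp only [blockValue, State.after, Site.rank_node]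
    rw [orderedProd_update ha]
    rcases (χ i).left_or_right with h | h
    · rw [pos_left h, h, P.cutMoment_left _ _ _ hi, BBProbSpace.cut, prodBelow_succ_of_mem ha]
      simp only [mulAfter, mul_assoc]
    · rw [pos_right h, h, P.cutMoment_right _ _ _ (by omega), BBProbSpace.cut,
        show 2 * n - (2 * n - 1 - i.val + 1) = i.val by omega, prodFrom_of_mem ha]
      simp only [mulAfter, mul_assoc]
  | top => simp at hat

theorem blockValue_before {V : Finset (Fin n)} (X : State B A n) {c : Site n} (hc : c.IsIn V)
    (hcb : 0 < c.rank χ) (b : B) : blockValue P V (X.before P χ c b) =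
      X.l * P.cutMoment V X.T (c.rank χ - 1) b * X.r := by
  cases c with
  | bot => simp at hcb
  | node i =>
    have hi := i.isLt
    simp only [blockValue, State.before, Site.rank_node, Nat.add_sub_cancel]
    rw [orderedProd_update hc]
    rcases (χ i).left_or_right with h | h
    · rw [pos_left h, h, P.cutMoment_left _ _ _ hi.le, BBProbSpace.cut, prodFrom_of_mem hc]
      simp only [mulBefore, mul_assoc]
    · rw [pos_right h, h, P.cutMoment_right _ _ _ (by omega), BBProbSpace.cut,
        show 2 * n - (2 * n - 1 - i.val) = i.val + 1 by omega, prodBelow_succ_of_mem hc]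
      simp only [mulBefore, mul_assoc]
  | top => simp [blockValue, State.before, P.cutMoment_top, mul_assoc]

theorem Site.rank_le {n : ℕ} (χ : Fin n → Side) (a : Site n) : a.rank χ ≤ 2 * n + 1 := by
  cases a with
  | bot => simp
  | node i => have := pos_lt χ i; simp; omega
  | top => simp

/-- No node of `V` has a position from `a.rank` up to, but excluding, `c.rank - 1`, so the inserted
element slides freely between these two places. -/
theorem blockValue_after_eq_before {V : Finset (Fin n)} {X : State B A n} (hX : X.Adapted P χ)
    {a c : Site n} (h : Consecutive χ V a c) (b : B) :
    blockValue P V (X.after P χ a b) = blockValue P V (X.before P χ c b) := by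
  have h₁ := h.lt
  have h₂ := c.rank_le χ
  rw [blockValue_after X h.left_isIn (by omega), blockValue_before X h.right_isIn (by omega),
    P.cutMoment_eq hX b (p := a.rank χ) (q := c.rank χ - 1) (by omega) (by omega)]
  intro i hi
  have := h.not_between i hi
  omega

end OneBlock

/-! ### The steps of the recursion -/

section Steps

variable {n : ℕ} {χ : Fin n → Side} {π : Setoid (Fin n)} {S : Finset (Fin n)}

theorem mem_blockOf {v j : Fin n} : j ∈ blockOf π S v ↔ j ∈ S ∧ π.r v j := by
  simp [blockOf]

theorem mem_sdiff_blockOf {v j : Fin n} : j ∈ S \ blockOf π S v ↔ j ∈ S ∧ ¬ π.r v j := by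
  rw [Finset.mem_sdiff, mem_blockOf]
  tauto

/-- `v` is the minimum of its block in `S`, and every other block of `S` starts before `v`. -/
structure IsLowest (π : Setoid (Fin n)) (S : Finset (Fin n)) (v : Fin n) : Prop where
  mem : v ∈ S
  le : ∀ j ∈ S, π.r v j → v ≤ j
  exists_lt : ∀ j ∈ S, ¬ π.r v j → ∃ i ∈ S, π.r i j ∧ i < v

theorem isLowest_lowestStart (hS : S.Nonempty) : IsLowest π S (lowestStart π S hS) := by
  classical
  have hv := Finset.mem_filter.1 ((blockMinima π S).max'_mem (blockMinima_nonempty π hS))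
  refine ⟨hv.1, hv.2, fun j hj hvj => ?_⟩
  obtain ⟨m, hm, hmj⟩ := exists_blockMinima π S hj
  refine ⟨m, (Finset.mem_filter.1 hm).1, hmj, lt_of_le_of_ne (Finset.le_max' _ _ hm) ?_⟩
  rintro rfl
  exact hvj hmj

theorem IsLowest.unique {v w : Fin n} (hv : IsLowest π S v) (hw : IsLowest π S w) : v = w := by
  by_cases h : π.r v w
  · exact le_antisymm (hv.le w hw.mem h) (hw.le v hv.mem (π.iseqv.symm h))
  · obtain ⟨i, hi, hiw, hlt⟩ := hv.exists_lt w hw.mem h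
    obtain ⟨j, hj, hjv, hlt'⟩ := hw.exists_lt v hv.mem fun h' => h (π.iseqv.symm h')
    have h₁ := hw.le i hi (π.iseqv.symm hiw)
    have h₂ := hv.le j hj (π.iseqv.symm hjv)
    exact absurd (hlt.trans_le (h₂.trans hlt'.le)) (not_lt.2 h₁)

theorem IsLowest.eq {v : Fin n} (hv : IsLowest π S v) (hS : S.Nonempty) :
    lowestStart π S hS = v := (isLowest_lowestStart hS).unique hv

theorem IsLowest.card_lt {v : Fin n} (hv : IsLowest π S v) :
    (S \ blockOf π S v).card < S.card := card_sdiff_blockOf_lt π S v hv.mem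

/-- `S` consists of one block. -/
def OneBlock (π : Setoid (Fin n)) (S : Finset (Fin n)) : Prop := ∀ i ∈ S, ∀ j ∈ S, π.r i j

theorem exists_isLowest (h : ¬ OneBlock π S) : ∃ v, IsLowest π S v :=
  ⟨_, isLowest_lowestStart (nonempty_of_not_oneBlock π S h)⟩

theorem exists_not_rel (h : ¬ OneBlock π S) (v : Fin n) :
    ∃ j ∈ S, ¬ π.r v j := by
  by_contra hc
  push Not at hc
  exact h fun i hi j hj => π.iseqv.trans (π.iseqv.symm (hc i hi)) (hc j hj)

theorem sdiff_blockOf_nonempty' (h : ¬ OneBlock π S) (v : Fin n) :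
    (S \ blockOf π S v).Nonempty := by
  obtain ⟨j, hj, hvj⟩ := exists_not_rel h v
  exact ⟨j, mem_sdiff_blockOf.2 ⟨hj, hvj⟩⟩

/-- Every block other than that of `v` starts above `v`, so each of its nodes below `v` is
automatically on a spine passing `v`. -/
theorem IsLowest.mem_spineNodes {v j : Fin n} (hv : IsLowest π S v) :
    j ∈ spineNodes π S v ↔ j ∈ S ∧ v < j ∧ ¬ π.r v j := by
  classical
  simp only [spineNodes, Finset.mem_filter]
  constructor
  · rintro ⟨hj, hlt, i, hi, hiv, hij⟩
    exact ⟨hj, hlt, fun h => absurd (hv.le i hi (π.iseqv.trans h (π.iseqv.symm hij)))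
      (not_le.2 hiv)⟩
  · rintro ⟨hj, hlt, h⟩
    obtain ⟨i, hi, hij, hiv⟩ := hv.exists_lt j hj h
    exact ⟨hj, hlt, i, hi, hiv, hij⟩

theorem key_le_iff {a b : Fin n} : key χ a ≤ key χ b ↔ pos χ a ≤ pos χ b := by
  rw [← not_lt, ← not_lt, key_lt_iff]

/-- `a` comes no later than `j` when seen from side `s`. -/
def SeenFirst (χ : Fin n → Side) : Side → Fin n → Fin n → Prop
  | .left, a, j => pos χ a ≤ pos χ j
  | .right, a, j => pos χ j ≤ pos χ a

theorem seenFirst_adjacentNode (N : Finset (Fin n)) (hN : N.Nonempty) (s : Side) :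
    ∀ j ∈ N, SeenFirst χ s (adjacentNode χ N hN s) j := by
  cases s
  · exact fun j hj => key_le_iff.1 ((N.exists_min_image (key χ) hN).choose_spec.2 j hj)
  · exact fun j hj => key_le_iff.1 ((N.exists_max_image (key χ) hN).choose_spec.2 j hj)

theorem SeenFirst.antisymm {s : Side} {a b : Fin n} (h : SeenFirst χ s a b)
    (h' : SeenFirst χ s b a) : a = b := by
  cases s
  · exact pos_injective (le_antisymm h h')
  · exact pos_injective (le_antisymm h' h)

/-- `a` is the first node below `v`, seen from the side of `v`, of a block other than that of `v`,
and `k` is the first node below `v` in the block of `a`. -/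
structure IsInsertion (χ : Fin n → Side) (π : Setoid (Fin n)) (S : Finset (Fin n))
    (v a k : Fin n) : Prop where
  mem : a ∈ S
  lt : v < a
  not_rel : ¬ π.r v a
  first : ∀ j ∈ S, v < j → ¬ π.r v j → SeenFirst χ (χ v) a j
  mem' : k ∈ S
  lt' : v < k
  rel : π.r a k
  le : ∀ j ∈ S, v < j → π.r a j → k ≤ j

theorem IsInsertion.not_rel' {v a k : Fin n} (h : IsInsertion χ π S v a k) : ¬ π.r v k :=
  fun hvk => h.not_rel (π.iseqv.trans hvk (π.iseqv.symm h.rel))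

theorem mem_belowOnAdjacent {v j : Fin n} (hN : (spineNodes π S v).Nonempty) :
    j ∈ belowOnAdjacent χ π S v hN ↔
      j ∈ S ∧ v < j ∧ π.r (adjacentNode χ (spineNodes π S v) hN (χ v)) j := by
  simp only [belowOnAdjacent, Finset.mem_filter, mem_blockOf]
  tauto

theorem IsLowest.isInsertion {v : Fin n} (hv : IsLowest π S v)
    (hN : (spineNodes π S v).Nonempty) :
    IsInsertion χ π S v (adjacentNode χ (spineNodes π S v) hN (χ v))
      ((belowOnAdjacent χ π S v hN).min' (belowOnAdjacent_nonempty χ π S v hN)) := by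
  have ha := hv.mem_spineNodes.1 (adjacentNode_mem χ (spineNodes π S v) hN (χ v))
  have hk := (mem_belowOnAdjacent hN).1 (Finset.min'_mem _ (belowOnAdjacent_nonempty χ π S v hN))
  exact ⟨ha.1, ha.2.1, ha.2.2,
    fun j hj hvj hr => seenFirst_adjacentNode _ hN _ j (hv.mem_spineNodes.2 ⟨hj, hvj, hr⟩),
    hk.1, hk.2.1, hk.2.2,
    fun j hj hvj hr => Finset.min'_le _ _ ((mem_belowOnAdjacent hN).2 ⟨hj, hvj, hr⟩)⟩

/-- `momentOn` picks the adjacent node by choice. Uniqueness lets the recursion be used with any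
nodes that satisfy the description, which is also what makes it transportable along embeddings. -/
theorem IsInsertion.unique {v a k a' k' : Fin n} (h : IsInsertion χ π S v a k)
    (h' : IsInsertion χ π S v a' k') : k = k' := by
  obtain rfl : a = a' := (h.first a' h'.mem h'.lt h'.not_rel).antisymm
    (h'.first a h.mem h.lt h.not_rel)
  exact le_antisymm (h.le k' h'.mem' h'.lt' h'.rel) (h'.le k h.mem' h.lt' h.rel)

theorem IsLowest.exists_isInsertion {v : Fin n} (hv : IsLowest π S v)
    (h : ¬ ∀ j ∈ S, v < j → π.r v j) : ∃ a k, IsInsertion χ π S v a k := by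
  push Not at h
  obtain ⟨j, hj, hvj, hr⟩ := h
  exact ⟨_, _, hv.isInsertion ⟨j, hv.mem_spineNodes.2 ⟨hj, hvj, hr⟩⟩⟩

/-! ### One step of the recursion, and which changes of the operators it does not see -/

variable {B A : Type*} [Ring B] [Algebra ℂ B] [Ring A] [Algebra ℂ A] (P : BBProbSpace B A)

theorem momentOn_of_oneBlock (χ : Fin n → Side) (h : OneBlock π S) (T : Fin n → A) :
    momentOn P χ π S T = P.E (orderedProd S T) := by
  unfold OneBlock at h
  rw [momentOn, dif_pos h]

theorem momentOn_of_last {v k : Fin n} (hS : ¬ OneBlock π S) (hv : IsLowest π S v)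
    (h : ∀ j ∈ S, v < j → π.r v j) (hk : k ∈ S) (hvk : ¬ π.r v k)
    (hmax : ∀ j ∈ S, ¬ π.r v j → j ≤ k) (T : Fin n → A) :
    momentOn P χ π S T = momentOn P χ π (S \ blockOf π S v)
      (Function.update T k (T k * P.op (χ v) (P.E (orderedProd (blockOf π S v) T)))) := by
  have hne := nonempty_of_not_oneBlock π S hS
  obtain rfl := hv.eq hne
  unfold OneBlock at hS
  rw [momentOn, dif_neg hS]
  dsimp only
  rw [dif_pos fun j hj hlt => mem_blockOf.2 ⟨hj, h j hj hlt⟩]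
  have hk' : (S \ blockOf π S (lowestStart π S hne)).max'
      (sdiff_blockOf_nonempty π S _ hS) = k := by
    refine le_antisymm (Finset.max'_le _ _ _ fun j hj => ?_)
      (Finset.le_max' _ _ (mem_sdiff_blockOf.2 ⟨hk, hvk⟩))
    rw [mem_sdiff_blockOf] at hj
    exact hmax j hj.1 hj.2
  simp only [hk']

theorem momentOn_of_isInsertion {v a k : Fin n} (hv : IsLowest π S v)
    (h : IsInsertion χ π S v a k) (T : Fin n → A) :
    momentOn P χ π S T = momentOn P χ π (S \ blockOf π S v)
      (Function.update T k (P.op (χ v) (P.E (orderedProd (blockOf π S v) T)) * T k)) := by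
  have hS : ¬ OneBlock π S := fun hS => h.not_rel (hS v hv.mem a h.mem)
  have hne := nonempty_of_not_oneBlock π S hS
  obtain rfl := hv.eq hne
  unfold OneBlock at hS
  rw [momentOn, dif_neg hS]
  dsimp only
  rw [dif_neg fun hc => h.not_rel (mem_blockOf.1 (hc a h.mem h.lt)).2]
  have hN : (spineNodes π S (lowestStart π S hne)).Nonempty :=
    ⟨a, hv.mem_spineNodes.2 ⟨h.mem, h.lt, h.not_rel⟩⟩
  have hk' := (hv.isInsertion (χ := χ) hN).unique h
  simp only [hk']

/-- The step of the recursion in the form used when only the place of insertion matters. -/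
theorem exists_momentOn_step (χ : Fin n → Side) (hS : ¬ OneBlock π S) :
    ∃ v k, IsLowest π S v ∧ k ∈ S \ blockOf π S v ∧
      (((∀ j ∈ S, v < j → π.r v j) ∧ (∀ j ∈ S, ¬ π.r v j → j ≤ k) ∧ ∀ T : Fin n → A,
        momentOn P χ π S T = momentOn P χ π (S \ blockOf π S v)
          (Function.update T k (T k * P.op (χ v) (P.E (orderedProd (blockOf π S v) T))))) ∨
      ((∃ a, IsInsertion χ π S v a k) ∧ ∀ T : Fin n → A,
        momentOn P χ π S T = momentOn P χ π (S \ blockOf π S v)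
          (Function.update T k (P.op (χ v) (P.E (orderedProd (blockOf π S v) T)) * T k)))) := by
  obtain ⟨v, hv⟩ := exists_isLowest hS
  by_cases h : ∀ j ∈ S, v < j → π.r v j
  · have hne := sdiff_blockOf_nonempty' hS v
    have hk := Finset.max'_mem _ hne
    have hmax : ∀ j ∈ S, ¬ π.r v j → j ≤ (S \ blockOf π S v).max' hne :=
      fun j hj hr => Finset.le_max' _ _ (mem_sdiff_blockOf.2 ⟨hj, hr⟩)
    refine ⟨v, _, hv, hk, Or.inl ⟨h, hmax, fun T => ?_⟩⟩
    rw [mem_sdiff_blockOf] at hk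
    exact momentOn_of_last P hS hv h hk.1 hk.2 hmax T
  · obtain ⟨a, k, hi⟩ := hv.exists_isInsertion (χ := χ) h
    exact ⟨v, k, hv, mem_sdiff_blockOf.2 ⟨hi.mem', hi.not_rel'⟩, Or.inr ⟨⟨a, hi⟩, fun T =>
      momentOn_of_isInsertion P hv hi T⟩⟩

theorem blockOf_sdiff {v j : Fin n} (hj : j ∈ S \ blockOf π S v) :
    blockOf π (S \ blockOf π S v) j = blockOf π S j := by
  ext i
  rw [mem_blockOf, mem_blockOf, mem_sdiff_blockOf]
  rw [mem_sdiff_blockOf] at hj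
  exact ⟨fun h => ⟨h.1.1, h.2⟩, fun h =>
    ⟨⟨h.1, fun hvi => hj.2 (π.iseqv.trans hvi (π.iseqv.symm h.2))⟩, h.2⟩⟩

theorem OneBlock.blockOf_eq (h : OneBlock π S) {j : Fin n} (hj : j ∈ S) : blockOf π S j = S := by
  ext i
  rw [mem_blockOf]
  exact ⟨fun hi => hi.1, fun hi => ⟨hi, h j hj i hi⟩⟩

/-- The value `E_{π|_S}` depends on the operators below the height `h` only through their products
over the blocks, as long as every block starts above `h`. -/
theorem momentOn_congr_below {S : Finset (Fin n)} {h : ℕ} {T T' : Fin n → A}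
    (hh : ∀ j ∈ S, ∃ i ∈ S, π.r i j ∧ i.val < h) (hT : ∀ i ∈ S, i.val < h → T i = T' i)
    (hprod : ∀ j ∈ S, prodFrom (blockOf π S j) h T = prodFrom (blockOf π S j) h T') :
    momentOn P χ π S T = momentOn P χ π S T' := by
  induction hc : S.card using Nat.strong_induction_on generalizing S T T' with
  | _ c ih =>
  subst hc
  have hblock : ∀ j ∈ S, orderedProd (blockOf π S j) T = orderedProd (blockOf π S j) T' := by
    intro j hj
    rw [← prodBelow_mul_prodFrom _ h, ← prodBelow_mul_prodFrom _ h, hprod j hj,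
      prodBelow_congr fun k hk => hT k (mem_blockOf.1 hk).1]
  by_cases hS : OneBlock π S
  · rw [momentOn_of_oneBlock P χ hS, momentOn_of_oneBlock P χ hS]
    rcases S.eq_empty_or_nonempty with rfl | ⟨j, hj⟩
    · simp
    · have := hblock j hj
      rw [hS.blockOf_eq hj] at this
      rw [this]
  obtain ⟨v, k, hv, hk, hstep⟩ := exists_momentOn_step P χ hS
  have hvh : v.val < h := by
    obtain ⟨i, hi, hiv, hlt⟩ := hh v hv.mem
    exact lt_of_le_of_lt (Fin.le_def.1 (hv.le i hi (π.iseqv.symm hiv))) hlt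
  have hhK : ∀ j ∈ S \ blockOf π S v, ∃ i ∈ S \ blockOf π S v, π.r i j ∧ i.val < h := by
    intro j hj
    rw [mem_sdiff_blockOf] at hj
    obtain ⟨i, hi, hij, hlt⟩ := hh j hj.1
    exact ⟨i, mem_sdiff_blockOf.2 ⟨hi, fun hvi => hj.2 (π.iseqv.trans hvi hij)⟩, hij, hlt⟩
  -- A change at `k` affects the product from `h` on only for the block of `k`, and only if `k` is
  -- not above `h`.
  have hother : ∀ (y y' : A), ∀ j ∈ S \ blockOf π S v, (k.val < h ∨ ¬ π.r j k) →
      prodFrom (blockOf π (S \ blockOf π S v) j) h (Function.update T k y) =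
        prodFrom (blockOf π (S \ blockOf π S v) j) h (Function.update T' k y') := by
    intro y y' j hj hjk
    have hne : ∀ i ∈ blockOf π S j, h ≤ i.val → i ≠ k := by
      rintro i hi hle rfl
      exact hjk.elim (fun hlt => by omega) fun hr => hr (mem_blockOf.1 hi).2
    rw [blockOf_sdiff hj, prodFrom_congr fun i hi hle => Function.update_of_ne (hne i hi hle) _ _,
      hprod j (mem_sdiff_blockOf.1 hj).1,
      prodFrom_congr fun i hi hle => Function.update_of_ne (hne i hi hle) _ _]
  have hupd : ∀ (y y' : A), (k.val < h → y = y') → ∀ i ∈ S \ blockOf π S v, i.val < h →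
      Function.update T k y i = Function.update T' k y' i := by
    intro y y' hy i hi hlt
    rcases eq_or_ne i k with rfl | hik
    · rw [Function.update_self, Function.update_self, hy hlt]
    · rw [Function.update_of_ne hik, Function.update_of_ne hik]
      exact hT i (mem_sdiff_blockOf.1 hi).1 hlt
  have hk' := mem_sdiff_blockOf.1 hk
  rcases hstep with ⟨hlast, hmax, hstep⟩ | ⟨⟨a, hins⟩, hstep⟩
  -- Here all nodes below `v` belong to its block; since `v` is above `h`, a node `k` outside that
  -- block must be above `h` too.
  · have hkh : k.val < h := by
      by_contra hle
      exact hk'.2 (hlast k hk'.1 (Fin.lt_def.2 (by omega)))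
    rw [hstep, hstep, hblock v hv.mem]
    exact ih _ hv.card_lt hhK (hupd _ _ fun hlt => by rw [hT k hk'.1 hlt])
      (fun j hj => hother _ _ j hj (Or.inl hkh)) rfl
  · rw [hstep, hstep, hblock v hv.mem]
    refine ih _ hv.card_lt hhK (hupd _ _ fun hlt => by rw [hT k hk'.1 hlt]) (fun j hj => ?_) rfl
    by_cases hjk : k.val < h ∨ ¬ π.r j k
    · exact hother _ _ j hj hjk
    · push Not at hjk
      have hj' := mem_sdiff_blockOf.1 hj
      -- As `v` is above `h`, the first node of the spine below `v`, if not above `h`, is also the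
      -- first one from `h` on. The inserted factor therefore stands at the left end of the product
      -- from `h`, which it simply multiplies.
      have hfirst : ∀ i ∈ blockOf π S j, h ≤ i.val → k ≤ i := fun i hi hle =>
        hins.le i (mem_blockOf.1 hi).1 (Fin.lt_def.2 (by omega))
          (π.iseqv.trans hins.rel (π.iseqv.trans (π.iseqv.symm hjk.2) (mem_blockOf.1 hi).2))
      have hkj : k ∈ blockOf π S j := mem_blockOf.2 ⟨hk'.1, hjk.2⟩
      rw [blockOf_sdiff hj, prodFrom_update_mul hkj hjk.1 hfirst,
        prodFrom_update_mul hkj hjk.1 hfirst, hprod j hj'.1]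

/-- With the height `n` every node is above the cut, so all products below it are empty. -/
theorem momentOn_congr {S : Finset (Fin n)} {T T' : Fin n → A} (hT : ∀ i ∈ S, T i = T' i) :
    momentOn P χ π S T = momentOn P χ π S T' := by
  refine momentOn_congr_below P (h := n) (fun j hj => ⟨j, hj, π.iseqv.refl j, j.isLt⟩)
    (fun i hi _ => hT i hi) fun j hj => ?_
  rw [prodFrom_of_lt fun i _ => i.isLt, prodFrom_of_lt fun i _ => i.isLt]

theorem E_orderedProd_update_mul_op {V : Finset (Fin n)} {k : Fin n} (hk : k ∈ V)
    (hmax : ∀ j ∈ V, j ≤ k) (T : Fin n → A) (y : A) (b : B) (s s' : Side) :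
    P.E (orderedProd V (Function.update T k (y * P.op s b))) =
      P.E (orderedProd V (Function.update T k (y * P.op s' b))) := by
  rw [orderedProd_update hk, orderedProd_update hk,
    prodFrom_of_lt fun i hi => Nat.lt_succ_of_le (Fin.le_def.1 (hmax i hi)), mul_one, mul_one,
    ← mul_assoc, ← mul_assoc, P.E_mul_op b _ s s']

/-- On the last operator, `L_b` and `R_b` act equally from the right. -/
theorem momentOn_update_mul_op {S : Finset (Fin n)} {k : Fin n} (hk : k ∈ S)
    (hmax : ∀ j ∈ S, j ≤ k) (T : Fin n → A) (y : A) (b : B) (s s' : Side) :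
    momentOn P χ π S (Function.update T k (y * P.op s b)) =
      momentOn P χ π S (Function.update T k (y * P.op s' b)) := by
  induction hc : S.card using Nat.strong_induction_on generalizing S T y with
  | _ c ih =>
  subst hc
  by_cases hS : OneBlock π S
  · rw [momentOn_of_oneBlock P χ hS, momentOn_of_oneBlock P χ hS,
      E_orderedProd_update_mul_op P hk hmax T y b s s']
  obtain ⟨v, k', hv, hk', hstep⟩ := exists_momentOn_step P χ hS
  -- If `k` is in the block being removed, `L_b` and `R_b` already agree inside its expectation, and
  -- the remainder does not contain `k`.
  by_cases hvk : π.r v k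
  · have hkV : k ∈ blockOf π S v := mem_blockOf.2 ⟨hk, hvk⟩
    have hE := E_orderedProd_update_mul_op P hkV (fun j hj => hmax j (mem_blockOf.1 hj).1)
      T y b s s'
    have hne : ∀ i ∈ S \ blockOf π S v, i ≠ k := by
      rintro i hi rfl
      exact (mem_sdiff_blockOf.1 hi).2 hvk
    have hcongr : ∀ z z' w w' : A, w = w' →
        momentOn P χ π (S \ blockOf π S v) (Function.update (Function.update T k z) k' w) =
          momentOn P χ π (S \ blockOf π S v) (Function.update (Function.update T k z') k' w') := by
      rintro z z' w _ rfl
      refine momentOn_congr P fun i hi => ?_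
      rcases eq_or_ne i k' with rfl | hik
      · simp
      · simp [hik, hne i hi]
    rcases hstep with ⟨-, -, hstep⟩ | ⟨-, hstep⟩
    · rw [hstep, hstep, hE]
      exact hcongr _ _ _ _ (by simp [hne k' hk'])
    · rw [hstep, hstep, hE]
      exact hcongr _ _ _ _ (by simp [hne k' hk'])
  · have hkK : k ∈ S \ blockOf π S v := mem_sdiff_blockOf.2 ⟨hk, hvk⟩
    have hkV : k ∉ blockOf π S v := fun h => hvk (mem_blockOf.1 h).2
    have hmaxK : ∀ j ∈ S \ blockOf π S v, j ≤ k := fun j hj => hmax j (mem_sdiff_blockOf.1 hj).1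
    -- The last node `k` lies below `v` and outside its block, so the insertion is to the left of an
    -- operator. The factor on the right of `T k` stays where it is.
    rcases hstep with ⟨hlast, -, -⟩ | ⟨-, hstep⟩
    · refine absurd (hlast k hk (lt_of_le_of_ne (hmax v hv.mem) ?_)) hvk
      rintro rfl
      exact hvk (π.iseqv.refl v)
    · rw [hstep, hstep, orderedProd_update_of_notMem hkV, orderedProd_update_of_notMem hkV]
      rcases eq_or_ne k' k with rfl | hne
      · simp only [Function.update_self, Function.update_idem, ← mul_assoc]
        exact ih _ hv.card_lt hkK hmaxK _ _ rfl
      · rw [Function.update_of_ne hne, Function.update_of_ne hne, Function.update_comm hne.symm,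
          Function.update_comm hne.symm]
        exact ih _ hv.card_lt hkK hmaxK _ _ rfl

end Steps

/-! ### Removing the lowest block -/

section Around

variable {n : ℕ} {χ : Fin n → Side} {S V : Finset (Fin n)} {a c : Site n}

/-- `a` and `c` are the sites of `S \ V` that immediately surround `V` along `≺_χ`. -/
structure Around (χ : Fin n → Side) (S V : Finset (Fin n)) (a c : Site n) : Prop where
  left_isIn : a.IsIn (S \ V)
  right_isIn : c.IsIn (S \ V)
  left_lt : ∀ k ∈ V, a.rank χ < pos χ k + 1
  lt_right : ∀ k ∈ V, pos χ k + 1 < c.rank χ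
  not_between : ∀ k ∈ S \ V, pos χ k + 1 ≤ a.rank χ ∨ c.rank χ ≤ pos χ k + 1

theorem Around.consecutive (h : Around χ S V a c) (hV : V.Nonempty) :
    Consecutive χ (S \ V) a c := by
  obtain ⟨k, hk⟩ := hV
  exact ⟨h.left_isIn, h.right_isIn, (h.left_lt k hk).trans (h.lt_right k hk), h.not_between⟩

theorem Around.left_ne_top (h : Around χ S V a c) (hV : V.Nonempty) : a ≠ .top := by
  obtain ⟨k, hk⟩ := hV
  rintro rfl
  have h₁ := h.left_lt k hk
  have h₂ := pos_lt χ k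
  simp at h₁
  omega

theorem Around.right_ne_bot (h : Around χ S V a c) (hV : V.Nonempty) : c ≠ .bot := by
  obtain ⟨k, hk⟩ := hV
  rintro rfl
  have h₁ := h.lt_right k hk
  simp at h₁

theorem exists_site_before (χ : Fin n → Side) (K : Finset (Fin n)) (p : ℕ) :
    ∃ a : Site n, a.IsIn K ∧ a.rank χ ≤ p ∧ ∀ k ∈ K, pos χ k < p → pos χ k + 1 ≤ a.rank χ := by
  rcases (K.filter fun k => pos χ k < p).eq_empty_or_nonempty with h | h
  · refine ⟨.bot, trivial, Nat.zero_le _, fun k hk hlt => ?_⟩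
    exact absurd (h ▸ Finset.mem_filter.2 ⟨hk, hlt⟩) (Finset.notMem_empty k)
  · obtain ⟨i, hi, hmax⟩ := Finset.exists_max_image _ (pos χ) h
    rw [Finset.mem_filter] at hi
    exact ⟨.node i, hi.1, hi.2, fun k hk hlt =>
      Nat.succ_le_succ (hmax k (Finset.mem_filter.2 ⟨hk, hlt⟩))⟩

theorem exists_site_after (χ : Fin n → Side) (K : Finset (Fin n)) {p : ℕ} (hp : p < 2 * n) :
    ∃ c : Site n, c.IsIn K ∧ p + 1 < c.rank χ ∧ ∀ k ∈ K, p < pos χ k → c.rank χ ≤ pos χ k + 1 := by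
  rcases (K.filter fun k => p < pos χ k).eq_empty_or_nonempty with h | h
  · refine ⟨.top, trivial, by simpa using hp, fun k hk hlt => ?_⟩
    exact absurd (h ▸ Finset.mem_filter.2 ⟨hk, hlt⟩) (Finset.notMem_empty k)
  · obtain ⟨i, hi, hmin⟩ := Finset.exists_min_image _ (pos χ) h
    rw [Finset.mem_filter] at hi
    exact ⟨.node i, hi.1, Nat.succ_lt_succ hi.2, fun k hk hlt =>
      Nat.succ_le_succ (hmin k (Finset.mem_filter.2 ⟨hk, hlt⟩))⟩

theorem exists_around (hV : V.Nonempty)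
    (h : ∀ k ∈ S \ V, ∀ u ∈ V, ∀ w ∈ V, pos χ u < pos χ k → ¬ pos χ k < pos χ w) :
    ∃ a c, Around χ S V a c := by
  obtain ⟨u, hu, hmin⟩ := Finset.exists_min_image V (pos χ) hV
  obtain ⟨w, hw, hmax⟩ := Finset.exists_max_image V (pos χ) hV
  obtain ⟨a, ha, hau, hak⟩ := exists_site_before χ (S \ V) (pos χ u)
  obtain ⟨c, hc, hwc, hck⟩ := exists_site_after χ (S \ V) (pos_lt χ w)
  refine ⟨a, c, ha, hc, fun k hk => by have := hmin k hk; omega,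
    fun k hk => by have := hmax k hk; omega, fun k hk => ?_⟩
  have h₁ := hak k hk
  have h₂ := hck k hk
  have h₃ := h k hk u hu w hw
  have hne : ∀ x ∈ V, pos χ x ≠ pos χ k := fun x hx e =>
    (Finset.mem_sdiff.1 hk).2 (pos_injective e ▸ hx)
  have h₄ := hne u hu
  have h₅ := hne w hw
  omega

theorem Consecutive.isIn_cases {K : Finset (Fin n)} (h : Consecutive χ K a c) {d : Site n}
    (hd : d.IsIn K) : d.rank χ ≤ a.rank χ ∨ c.rank χ ≤ d.rank χ := by
  cases d with
  | bot => exact Or.inl (Nat.zero_le _)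
  | node k => exact h.not_between k hd
  | top => exact Or.inr (c.rank_le χ)

end Around

/-! ### The lowest block as an interval, and the gap it leaves -/

section RemoveLowest

variable {n : ℕ} {χ : Fin n → Side} {π : Setoid (Fin n)} {S : Finset (Fin n)} {v : Fin n}

/-- `π` is non-crossing for `≺_χ`. -/
def NonCrossing (χ : Fin n → Side) (π : Setoid (Fin n)) : Prop :=
  ∀ u₁ v₁ u₂ v₂, pos χ u₁ < pos χ v₁ → pos χ v₁ < pos χ u₂ → pos χ u₂ < pos χ v₂ →
    π.r u₁ u₂ → π.r v₁ v₂ → π.r u₁ v₁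

theorem IsLowest.blockOf_nonempty (hv : IsLowest π S v) : (blockOf π S v).Nonempty :=
  ⟨v, mem_blockOf.2 ⟨hv.mem, π.iseqv.refl v⟩⟩

/-- Suppose `k`, outside the block, lay between two of its nodes `u` and `w`. The block of `k` has a
node `i` above `v`, while the block of `v` has none. A left node above `v` precedes that whole block
and a right one follows it, so `i` is outside the range from `u` to `w`, and `i`, `k` cross `u`,
`w`. -/
theorem IsLowest.exists_around (hπ : NonCrossing χ π) (hv : IsLowest π S v) :
    ∃ a c, Around χ S (blockOf π S v) a c := by
  refine BiFree.exists_around hv.blockOf_nonempty fun k hk u hu w hw huk hkw => ?_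
  rw [mem_sdiff_blockOf] at hk
  rw [mem_blockOf] at hu hw
  obtain ⟨i, hi, hik, hiv⟩ := hv.exists_lt k hk.1 hk.2
  have hvu := Fin.le_def.1 (hv.le u hu.1 hu.2)
  have hvw := Fin.le_def.1 (hv.le w hw.1 hw.2)
  rw [Fin.lt_def] at hiv
  have hri : ¬ π.r i v := fun h => hk.2 (π.iseqv.trans (π.iseqv.symm h) hik)
  have hkv : k.val ≠ v.val := fun e => hk.2 (Fin.ext e ▸ π.iseqv.refl k)
  have hvs := pos_cases χ v
  have hus := pos_cases χ u
  have hws := pos_cases χ w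
  have hks := pos_cases χ k
  rcases pos_cases χ i with his | his
  · by_cases h : pos χ i < pos χ u
    · exact hri (π.iseqv.trans
        (hπ i u k w h huk hkw hik (π.iseqv.trans (π.iseqv.symm hu.2) hw.2)) (π.iseqv.symm hu.2))
    · omega
  · by_cases h : pos χ w < pos χ i
    · exact hk.2 (π.iseqv.trans hu.2 (hπ u k w i huk hkw h
        (π.iseqv.trans (π.iseqv.symm hu.2) hw.2) (π.iseqv.symm hik)))
    · omega

variable {B A : Type*} [Ring B] [Algebra ℂ B] [Ring A] [Algebra ℂ A] (P : BBProbSpace B A)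

/-- The value `E_{π|_S}` of a state. -/
def stateMoment (χ : Fin n → Side) (π : Setoid (Fin n)) (S : Finset (Fin n)) (X : State B A n) :
    B :=
  X.l * momentOn P χ π S X.T * X.r

variable {P}

/-- To the right of the last operator `L` and `R` have the same effect, so the side of the inserted
factor can be chosen at will, for instance that of `k`. -/
theorem momentOn_eq_update_of_last (hS : ¬ OneBlock π S) (hv : IsLowest π S v)
    (hlast : ∀ j ∈ S, v < j → π.r v j) {k : Fin n} (hk : k ∈ S) (hvk : ¬ π.r v k)
    (hmax : ∀ j ∈ S, ¬ π.r v j → j ≤ k) (s : Side) (T : Fin n → A) :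
    momentOn P χ π S T = momentOn P χ π (S \ blockOf π S v)
      (Function.update T k (T k * P.op s (P.E (orderedProd (blockOf π S v) T)))) := by
  rw [momentOn_of_last P hS hv hlast hk hvk hmax, momentOn_update_mul_op P
    (mem_sdiff_blockOf.2 ⟨hk, hvk⟩) (fun j hj => ?_) T (T k) _ (χ v) s]
  rw [mem_sdiff_blockOf] at hj
  exact hmax j hj.1 hj.2

/-- The insertion may be moved along the adjacent spine to its first node below `v`, seen from the
side of `v`. -/
theorem momentOn_eq_update_of_isInsertion (hv : IsLowest π S v) {a k : Fin n}
    (h : IsInsertion χ π S v a k) {T : Fin n → A} (hT : ∀ k, T k ∈ P.face (χ k)) :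
    momentOn P χ π S T = momentOn P χ π (S \ blockOf π S v)
      (Function.update T a
        (match χ v with
          | .left => mulBefore P (χ a) (T a) (P.E (orderedProd (blockOf π S v) T))
          | .right => mulAfter P (χ a) (T a) (P.E (orderedProd (blockOf π S v) T)))) := by
  rw [momentOn_of_isInsertion P hv h]
  set x := P.E (orderedProd (blockOf π S v) T)
  -- Every remaining block starts above `v`, so by `momentOn_congr_below` at the height of `v` only
  -- the products below `v` count. It suffices that putting `y` at `a` multiplies the product of its
  -- block below `v` by the inserted factor.
  have hcongr : ∀ y : A, (∀ W : Finset (Fin n), a ∈ W →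
        (∀ i ∈ W, i ∈ S ∧ ¬ π.r v i) →
        prodFrom W v.val (Function.update T a y) = P.op (χ v) x * prodFrom W v.val T) →
      momentOn P χ π (S \ blockOf π S v) (Function.update T k (P.op (χ v) x * T k)) =
        momentOn P χ π (S \ blockOf π S v) (Function.update T a y) := by
    intro y hy
    refine momentOn_congr_below P (h := v.val) (fun j hj => ?_) (fun i _ hlt => ?_) fun j hj => ?_
    · rw [mem_sdiff_blockOf] at hj
      obtain ⟨i, hi, hij, hlt⟩ := hv.exists_lt j hj.1 hj.2
      exact ⟨i, mem_sdiff_blockOf.2 ⟨hi, fun hvi => hj.2 (π.iseqv.trans hvi hij)⟩, hij, hlt⟩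
    · have h₁ := Fin.lt_def.1 h.lt
      have h₂ := Fin.lt_def.1 h.lt'
      rw [Function.update_of_ne (by rintro rfl; omega), Function.update_of_ne (by rintro rfl; omega)]
    · rw [blockOf_sdiff hj]
      rw [mem_sdiff_blockOf] at hj
      by_cases hja : π.r j a
      · have hjk : π.r j k := π.iseqv.trans hja h.rel
        have hW : ∀ i ∈ blockOf π S j, i ∈ S ∧ ¬ π.r v i := fun i hi => by
          rw [mem_blockOf] at hi
          exact ⟨hi.1, fun hvi => hj.2 (π.iseqv.trans hvi (π.iseqv.symm hi.2))⟩
        rw [hy _ (mem_blockOf.2 ⟨h.mem, hja⟩) hW, prodFrom_update_mul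
          (mem_blockOf.2 ⟨h.mem', hjk⟩) (Fin.lt_def.1 h.lt').le]
        intro i hi hle
        refine h.le i (hW i hi).1 (lt_of_le_of_ne (Fin.le_def.2 hle) ?_)
          (π.iseqv.trans (π.iseqv.symm hja) (mem_blockOf.1 hi).2)
        rintro rfl
        exact (hW v hi).2 (π.iseqv.refl v)
      · have hne : ∀ i ∈ blockOf π S j, i ≠ k ∧ i ≠ a := by
          refine fun i hi => ⟨?_, ?_⟩
          · rintro rfl
            exact hja (π.iseqv.trans (mem_blockOf.1 hi).2 (π.iseqv.symm h.rel))
          · rintro rfl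
            exact hja (mem_blockOf.1 hi).2
        exact prodFrom_congr fun i hi _ => by
          rw [Function.update_of_ne (hne i hi).1, Function.update_of_ne (hne i hi).2]
  have hfirst : ∀ i ∈ S, ¬ π.r v i → v.val ≤ i.val → SeenFirst χ (χ v) a i ∧ v.val < i.val := by
    intro i hi hr hle
    have hlt : v < i := lt_of_le_of_ne (Fin.le_def.2 hle) (by rintro rfl; exact hr (π.iseqv.refl v))
    exact ⟨h.first i hi hlt hr, Fin.lt_def.1 hlt⟩
  have hva := Fin.lt_def.1 h.lt
  -- If the first node seen from the side of `v` is on the opposite side, all remaining nodes below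
  -- `v` are there, and the first one seen is the one of largest index.
  have hmax : (χ a ≠ χ v) → ∀ j ∈ S \ blockOf π S v, j ≤ a := by
    intro hs j hj
    rw [mem_sdiff_blockOf] at hj
    by_contra hlt
    have := (hfirst j hj.1 hj.2 (by rw [Fin.le_def] at hlt; omega)).1
    have h₁ := pos_cases χ a
    have h₂ := pos_cases χ j
    rw [Fin.le_def] at hlt
    rcases (χ v).left_or_right with hvs | hvs <;> rw [hvs] at this hs <;>
      simp only [SeenFirst] at this <;> rcases h₁ with h₁ | h₁ <;> simp only [h₁.1, ne_eq,
        not_true_eq_false, reduceCtorEq, not_false_eq_true] at hs <;> omega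
  have hside : ∀ i ∈ S, ¬ π.r v i → v.val ≤ i.val → (i.val < a.val ∨ χ a ≠ χ v) → χ i ≠ χ v := by
    intro i hi hr hle hia his
    have h₀ := (hfirst i hi hr hle).1
    have h₁ := pos_cases χ a
    have h₂ := pos_cases χ i
    rw [← his] at h₀ hia
    rcases h₂ with h₂ | h₂ <;> rw [h₂.1] at h₀ hia <;> simp only [SeenFirst] at h₀ <;>
      rcases h₁ with h₁ | h₁ <;> simp only [h₁.1, ne_eq, not_true_eq_false, reduceCtorEq,
        not_false_eq_true, or_true, or_false] at hia <;> omega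
  -- On the same side, the factor slides down to the left of `T a` past opposite operators. On
  -- opposite sides, it slides past `T a` as well and changes between `L` and `R` at the last node.
  by_cases hs : χ a = χ v
  · rw [hcongr (P.op (χ v) x * T a) fun W ha hW => P.prodFrom_update_op_mul hT ha hva.le (χ v) x
      fun i hi hle hlt => hside i (hW i hi).1 (hW i hi).2 hle (Or.inl hlt)]
    rw [hs]
    cases χ v <;> rfl
  · rw [hcongr (T a * P.op (χ v) x) fun W ha hW => P.prodFrom_update_mul_op hT ha hva.le (χ v) x
      fun i hi hle _ => hside i (hW i hi).1 (hW i hi).2 hle (Or.inr hs),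
      momentOn_update_mul_op P (mem_sdiff_blockOf.2 ⟨h.mem, h.not_rel⟩) (hmax hs) T (T a) x
      (χ v) (χ a)]
    cases hvs : χ v <;> cases has : χ a <;> simp_all <;> rfl

/-- Moving an element of `B` from one site to the next does not change the value. -/
def Balanced (P : BBProbSpace B A) (χ : Fin n → Side) (π : Setoid (Fin n)) (S : Finset (Fin n)) :
    Prop :=
  ∀ (X : State B A n), X.Adapted P χ → ∀ (a c : Site n), Consecutive χ S a c → ∀ b : B,
    stateMoment P χ π S (X.after P χ a b) = stateMoment P χ π S (X.before P χ c b)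

/-- In either case of the recursion the insertion can be made at a neighbour of the block. If the
block ends `S`, the largest remaining node is the left or right neighbour according to its side.
Otherwise the first node seen from `v` is the right neighbour for `v` on the left, and the left
neighbour for `v` on the right. Balance of the smaller set carries an insertion at the right
neighbour over to the left one. -/
theorem stateMoment_eq_after_of_isLowest (hS : ¬ OneBlock π S) (hv : IsLowest π S v)
    (hB : Balanced P χ π (S \ blockOf π S v)) {X : State B A n} (hX : X.Adapted P χ)
    {a c : Site n} (h : Around χ S (blockOf π S v) a c) :
    stateMoment P χ π S X = stateMoment P χ π (S \ blockOf π S v)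
      (X.after P χ a (P.E (orderedProd (blockOf π S v) X.T))) := by
  have hvV : v ∈ blockOf π S v := mem_blockOf.2 ⟨hv.mem, π.iseqv.refl v⟩
  have hav := h.left_lt v hvV
  have hcv := h.lt_right v hvV
  have hvs := pos_cases χ v
  set x := P.E (orderedProd (blockOf π S v) X.T) with hx
  have key₁ : ∀ k, a = .node k → momentOn P χ π S X.T = momentOn P χ π (S \ blockOf π S v)
      (Function.update X.T k (mulAfter P (χ k) (X.T k) x)) →
      stateMoment P χ π S X = stateMoment P χ π (S \ blockOf π S v) (X.after P χ a x) := by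
    rintro k rfl hk
    rw [stateMoment, hk]
    rfl
  have key₂ : ∀ k, c = .node k → momentOn P χ π S X.T = momentOn P χ π (S \ blockOf π S v)
      (Function.update X.T k (mulBefore P (χ k) (X.T k) x)) →
      stateMoment P χ π S X = stateMoment P χ π (S \ blockOf π S v) (X.after P χ a x) := by
    rintro k rfl hk
    rw [hB X hX _ _ (h.consecutive ⟨v, hvV⟩), stateMoment, hk]
    rfl
  -- No other node separates the block from its neighbours, so these can be recognised by comparison
  -- with `v` alone.
  have hleft : ∀ k ∈ S, ¬ π.r v k → pos χ k < pos χ v →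
      (∀ j ∈ S, ¬ π.r v j → pos χ j < pos χ v → pos χ j ≤ pos χ k) → a = .node k := by
    intro k hk hr hlt hmax
    have h₁ := h.not_between k (mem_sdiff_blockOf.2 ⟨hk, hr⟩)
    cases a with
    | bot => simp at h₁; omega
    | node j =>
      have hj := mem_sdiff_blockOf.1 h.left_isIn
      have h₂ := hmax j hj.1 hj.2
      simp only [Site.rank_node] at h₁ hav
      rw [pos_injective (χ := χ) (show pos χ j = pos χ k by omega)]
    | top => exact absurd rfl (h.left_ne_top ⟨v, hvV⟩)
  have hright : ∀ k ∈ S, ¬ π.r v k → pos χ v < pos χ k →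
      (∀ j ∈ S, ¬ π.r v j → pos χ v < pos χ j → pos χ k ≤ pos χ j) → c = .node k := by
    intro k hk hr hlt hmin
    have h₁ := h.not_between k (mem_sdiff_blockOf.2 ⟨hk, hr⟩)
    have h₀ := pos_lt χ k
    cases c with
    | bot => exact absurd rfl (h.right_ne_bot ⟨v, hvV⟩)
    | node j =>
      have hj := mem_sdiff_blockOf.1 h.right_isIn
      have h₂ := hmin j hj.1 hj.2
      simp only [Site.rank_node] at h₁ hcv
      rw [pos_injective (χ := χ) (show pos χ j = pos χ k by omega)]
    | top => simp at h₁; omega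
  have hne : ∀ j, ¬ π.r v j → j.val ≠ v.val := fun j hr e => hr (Fin.ext e ▸ π.iseqv.refl j)
  by_cases hlast : ∀ j ∈ S, v < j → π.r v j
  · have hK := sdiff_blockOf_nonempty' hS v
    obtain ⟨k, hkK, hmax⟩ := Finset.exists_max_image _ id hK
    have hk := mem_sdiff_blockOf.1 hkK
    have hmax' : ∀ j ∈ S, ¬ π.r v j → j ≤ k := fun j hj hr =>
      hmax j (mem_sdiff_blockOf.2 ⟨hj, hr⟩)
    have hjv : ∀ j ∈ S, ¬ π.r v j → j.val < v.val := fun j hj hr => by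
      have := mt (hlast j hj) hr
      have := hne j hr
      rw [Fin.lt_def] at *
      omega
    have hkv := hjv k hk.1 hk.2
    have hstep := momentOn_eq_update_of_last (P := P) (χ := χ) hS hv hlast hk.1 hk.2 hmax' (χ k) X.T
    have hks := pos_cases χ k
    rcases (χ k).left_or_right with hs | hs
    · refine key₁ k (hleft k hk.1 hk.2 ?_ fun j hj hr hlt => ?_) ?_
      · rw [pos_left hs]; omega
      · have := hjv j hj hr
        have := Fin.le_def.1 (hmax' j hj hr)
        have := pos_cases χ j
        rw [pos_left hs]; omega
      · rw [hstep, hs]; rfl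
    · refine key₂ k (hright k hk.1 hk.2 ?_ fun j hj hr hlt => ?_) ?_
      · rw [pos_right hs]; omega
      · have := hjv j hj hr
        have := Fin.le_def.1 (hmax' j hj hr)
        have := pos_cases χ j
        rw [pos_right hs]; omega
      · rw [hstep, hs]; rfl
  · obtain ⟨d, k, hins⟩ := hv.exists_isInsertion (χ := χ) hlast
    have hstep := momentOn_eq_update_of_isInsertion (P := P) hv hins hX
    have hds := pos_cases χ d
    have hvd := Fin.lt_def.1 hins.lt
    rcases (χ v).left_or_right with hs | hs
    · refine key₂ d (hright d hins.mem hins.not_rel ?_ fun j hj hr hlt => ?_) ?_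
      · rw [pos_left hs]; omega
      · have hjs := pos_cases χ j
        have := hne j hr
        by_cases hvj : v < j
        · have := hins.first j hj hvj hr
          rwa [hs] at this
        · rw [Fin.lt_def] at hvj
          rw [pos_left hs] at hlt
          omega
      · rw [hstep, hs]
    · refine key₁ d (hleft d hins.mem hins.not_rel ?_ fun j hj hr hlt => ?_) ?_
      · rw [pos_right hs]; omega
      · have hjs := pos_cases χ j
        have := hne j hr
        by_cases hvj : v < j
        · have := hins.first j hj hvj hr
          rwa [hs] at this
        · rw [Fin.lt_def] at hvj
          rw [pos_right hs] at hlt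
          omega
      · rw [hstep, hs]

end RemoveLowest

/-! ### Balancing and removal of intervals -/

section Removal

variable {n : ℕ} {χ : Fin n → Side} {π : Setoid (Fin n)} {S V : Finset (Fin n)}

theorem Site.IsIn.mono {K : Finset (Fin n)} (hK : K ⊆ S) {a : Site n} (ha : a.IsIn K) :
    a.IsIn S := by
  cases a with
  | bot => trivial
  | node i => exact hK ha
  | top => trivial

theorem Site.IsIn.sdiff {a : Site n} (ha : a.IsIn S) (h : ∀ k ∈ V, a ≠ .node k) :
    a.IsIn (S \ V) := by
  cases a with
  | bot => trivial
  | node i => exact Finset.mem_sdiff.2 ⟨ha, fun hi => h i hi rfl⟩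
  | top => trivial

theorem Site.IsIn.ne_node {a : Site n} (ha : a.IsIn S) {k : Fin n} (hk : k ∉ S) : a ≠ .node k := by
  rintro rfl
  exact hk ha

variable {B A : Type*} [Ring B] [Algebra ℂ B] [Ring A] [Algebra ℂ A] {P : BBProbSpace B A}

theorem stateMoment_after_node {i : Fin n} (hi : i ∉ S) (X : State B A n) (b : B) :
    stateMoment P χ π S (X.after P χ (.node i) b) = stateMoment P χ π S X := by
  rw [stateMoment, stateMoment, momentOn_congr P (T' := X.T) fun k hk =>
    X.after_T_of_ne (by rintro ⟨⟩; exact hi hk) b]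
  rfl

theorem stateMoment_before_node {i : Fin n} (hi : i ∉ S) (X : State B A n) (b : B) :
    stateMoment P χ π S (X.before P χ (.node i) b) = stateMoment P χ π S X := by
  rw [stateMoment, stateMoment, momentOn_congr P (T' := X.T) fun k hk =>
    X.before_T_of_ne (by rintro ⟨⟩; exact hi hk) b]
  rfl

theorem stateMoment_of_oneBlock (hS : OneBlock π S) (X : State B A n) :
    stateMoment P χ π S X = blockValue P S X := by
  rw [stateMoment, momentOn_of_oneBlock P χ hS, blockValue]

/-- This and the next two lemmas are the one-block case with trivial outer factors. They describe
how the value of the lowest block changes when an element is inserted at one of its own nodes; past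
its extreme nodes the element comes out as a factor. -/
theorem E_after_node_eq_before_node {X : State B A n} (hX : X.Adapted P χ) {i j : Fin n}
    (h : Consecutive χ V (.node i) (.node j)) (b : B) :
    P.E (orderedProd V (X.after P χ (.node i) b).T) =
      P.E (orderedProd V (X.before P χ (.node j) b).T) := by
  simpa [blockValue, State.after, State.before] using
    blockValue_after_eq_before (X := ⟨1, 1, X.T⟩) hX h b

theorem E_after_node_of_top {X : State B A n} (hX : X.Adapted P χ) {i : Fin n}
    (h : Consecutive χ V (.node i) .top) (b : B) :
    P.E (orderedProd V (X.after P χ (.node i) b).T) = P.E (orderedProd V X.T) * b := by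
  simpa [blockValue, State.after, State.before] using
    blockValue_after_eq_before (X := ⟨1, 1, X.T⟩) hX h b

theorem E_before_node_of_bot {X : State B A n} (hX : X.Adapted P χ) {j : Fin n}
    (h : Consecutive χ V .bot (.node j)) (b : B) :
    P.E (orderedProd V (X.before P χ (.node j) b).T) = b * P.E (orderedProd V X.T) := by
  simpa [blockValue, State.after, State.before] using
    (blockValue_after_eq_before (X := ⟨1, 1, X.T⟩) hX h b).symm

theorem Consecutive.to_top {a c : Site n} {W : Finset (Fin n)} (h : Consecutive χ S a c)
    (hW : W ⊆ S) (ha : a.IsIn W) (hc : ∀ k ∈ W, pos χ k + 1 < c.rank χ) :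
    Consecutive χ W a .top := by
  refine ⟨ha, trivial, ?_, fun k hk => ?_⟩
  · have h₁ := h.lt
    have h₂ := c.rank_le χ
    simp only [Site.rank_top]
    omega
  · have h₁ := h.not_between k (hW hk)
    have h₂ := hc k hk
    omega

theorem Consecutive.of_bot {a c : Site n} {W : Finset (Fin n)} (h : Consecutive χ S a c)
    (hW : W ⊆ S) (hc : c.IsIn W) (ha : ∀ k ∈ W, a.rank χ < pos χ k + 1) :
    Consecutive χ W .bot c := by
  refine ⟨trivial, hc, lt_of_le_of_lt (Nat.zero_le _) h.lt, fun k hk => ?_⟩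
  have h₁ := h.not_between k (hW hk)
  have h₂ := ha k hk
  omega

theorem Consecutive.mono {a c : Site n} {W : Finset (Fin n)} (h : Consecutive χ S a c)
    (hW : W ⊆ S) (ha : a.IsIn W) (hc : c.IsIn W) : Consecutive χ W a c :=
  ⟨ha, hc, h.lt, fun k hk => h.not_between k (hW hk)⟩

theorem Site.exists_or_forall_ne (V : Finset (Fin n)) (a : Site n) :
    (∃ i ∈ V, a = .node i) ∨ ∀ k ∈ V, a ≠ .node k := by
  by_cases h : ∃ i ∈ V, a = .node i
  · exact Or.inl h
  · push Not at h
    exact Or.inr h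

theorem orderedProd_after {a : Site n} (h : ∀ k ∈ V, a ≠ .node k) (X : State B A n) (b : B) :
    orderedProd V (X.after P χ a b).T = orderedProd V X.T :=
  orderedProd_congr fun k hk => X.after_T_of_ne (h k hk) b

theorem orderedProd_before {a : Site n} (h : ∀ k ∈ V, a ≠ .node k) (X : State B A n) (b : B) :
    orderedProd V (X.before P χ a b).T = orderedProd V X.T :=
  orderedProd_congr fun k hk => X.before_T_of_ne (h k hk) b

/-- Every value `E_{π|_S}` is balanced. -/
theorem balanced (P : BBProbSpace B A) (hπ : NonCrossing χ π) (S : Finset (Fin n)) :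
    Balanced P χ π S := by
  induction hc : S.card using Nat.strong_induction_on generalizing S with
  | _ N ih =>
  subst hc
  intro X hX a c h b
  by_cases hS : OneBlock π S
  · rw [stateMoment_of_oneBlock hS, stateMoment_of_oneBlock hS, blockValue_after_eq_before hX h]
  obtain ⟨v, hv⟩ := exists_isLowest hS
  obtain ⟨a', c', hac⟩ := hv.exists_around hπ
  have hB : Balanced P χ π (S \ blockOf π S v) := ih _ hv.card_lt _ rfl
  have hA : ∀ {Y : State B A n}, Y.Adapted P χ → stateMoment P χ π S Y = stateMoment P χ π
      (S \ blockOf π S v) (Y.after P χ a' (P.E (orderedProd (blockOf π S v) Y.T))) :=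
    fun hY => stateMoment_eq_after_of_isLowest hS hv hB hY hac
  have hVne := hv.blockOf_nonempty
  have hcons := hac.consecutive hVne
  have hC : ∀ {Y : State B A n}, Y.Adapted P χ → stateMoment P χ π S Y = stateMoment P χ π
      (S \ blockOf π S v) (Y.before P χ c' (P.E (orderedProd (blockOf π S v) Y.T))) :=
    fun hY => (hA hY).trans (hB _ hY _ _ hcons _)
  have hvV : v ∈ blockOf π S v := mem_blockOf.2 ⟨hv.mem, π.iseqv.refl v⟩
  have hVS : blockOf π S v ⊆ S := fun i hi => (mem_blockOf.1 hi).1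
  have hKS : S \ blockOf π S v ⊆ S := Finset.sdiff_subset
  have hnot : ∀ i ∈ blockOf π S v, i ∉ S \ blockOf π S v := fun i hi h =>
    (Finset.mem_sdiff.1 h).2 hi
  have ha'V : ∀ k ∈ blockOf π S v, a' ≠ .node k := fun k hk => hac.left_isIn.ne_node (hnot k hk)
  have hc'V : ∀ k ∈ blockOf π S v, c' ≠ .node k := fun k hk => hac.right_isIn.ne_node (hnot k hk)
  have hXa := hX.after a b
  have hXc := hX.before c b
  have hlt := h.lt
  -- Four cases, according to which of the two sites are nodes of the lowest block. If both are, the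
  -- value of that block is the same for both insertions and the remainder does not see them.
  rcases a.exists_or_forall_ne (blockOf π S v) with ⟨i, hi, rfl⟩ | ha <;>
    rcases c.exists_or_forall_ne (blockOf π S v) with ⟨j, hj, rfl⟩ | hc
  · rw [hA hXa, hA hXc, E_after_node_eq_before_node hX (h.mono hVS hi hj),
      State.after_comm _ (ha'V i hi).symm, stateMoment_after_node (hnot i hi),
      ← State.after_before_comm _ (ha'V j hj), stateMoment_before_node (hnot j hj)]
  · have h₁ := hac.left_lt i hi
    have h₂ := hac.lt_right i hi
    simp only [Site.rank_node] at hlt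
    -- The site `a` is the last node of the block, so `c` is its right neighbour. The element leaves
    -- the block as a right factor of its value, which is then attached before the same `c`.
    have hcc : c = c' := by
      apply Site.rank_injective (χ := χ)
      have h₃ := hcons.isIn_cases (h.right_isIn.sdiff hc)
      have h₄ := h.isIn_cases (hac.right_isIn.mono hKS)
      simp only [Site.rank_node] at h₄
      omega
    subst hcc
    rw [hC hXa, hC hXc, E_after_node_of_top hX (h.to_top hVS hi hac.lt_right),
      State.after_before_comm _ (hc'V i hi).symm, stateMoment_after_node (hnot i hi),
      orderedProd_before hc, State.before_before]
  · have h₁ := hac.left_lt j hj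
    have h₂ := hac.lt_right j hj
    simp only [Site.rank_node] at hlt
    have haa : a = a' := by
      apply Site.rank_injective (χ := χ)
      have h₃ := hcons.isIn_cases (h.left_isIn.sdiff ha)
      have h₄ := h.isIn_cases (hac.left_isIn.mono hKS)
      simp only [Site.rank_node] at h₄
      omega
    subst haa
    rw [hA hXa, hA hXc, E_before_node_of_bot hX (h.of_bot hVS hj hac.left_lt),
      ← State.after_before_comm _ (ha'V j hj), stateMoment_before_node (hnot j hj),
      orderedProd_after ha, State.after_after]
  · have haK := h.left_isIn.sdiff ha
    have hcK := h.right_isIn.sdiff hc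
    have h₁ := hcons.isIn_cases haK
    have h₂ := hcons.isIn_cases hcK
    have h₃ := hcons.lt
    have h₄ := h.not_between v hv.mem
    have h₅ := hac.left_lt v hvV
    have h₆ := hac.lt_right v hvV
    have hK := h.mono hKS haK hcK
    -- The sites `a` and `c` lie on the same side of the block. The value of the block is attached
    -- to its neighbour on the far side from them, which differs from both, so that the two
    -- insertions commute.
    by_cases hcase : c'.rank χ ≤ a.rank χ
    · have hne₁ : a ≠ a' := by rintro rfl; omega
      have hne₂ : c ≠ a' := by rintro rfl; omega
      rw [hA hXa, hA hXc, orderedProd_after ha, orderedProd_before hc, State.after_comm _ hne₁,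
        hB _ (hX.after _ _) _ _ hK, State.after_before_comm _ hne₂.symm]
    · have hne₁ : a ≠ c' := by rintro rfl; omega
      have hne₂ : c ≠ c' := by rintro rfl; omega
      rw [hC hXa, hC hXc, orderedProd_after ha, orderedProd_before hc,
        State.after_before_comm _ hne₁, hB _ (hX.before _ _) _ _ hK, State.before_comm _ hne₂]

theorem stateMoment_eq_after (hπ : NonCrossing χ π) {v : Fin n} (hS : ¬ OneBlock π S)
    (hv : IsLowest π S v) {X : State B A n} (hX : X.Adapted P χ) {a c : Site n}
    (h : Around χ S (blockOf π S v) a c) :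
    stateMoment P χ π S X = stateMoment P χ π (S \ blockOf π S v)
      (X.after P χ a (P.E (orderedProd (blockOf π S v) X.T))) :=
  stateMoment_eq_after_of_isLowest hS hv (balanced P hπ _) hX h

theorem stateMoment_eq_before (hπ : NonCrossing χ π) {v : Fin n} (hS : ¬ OneBlock π S)
    (hv : IsLowest π S v) {X : State B A n} (hX : X.Adapted P χ) {a c : Site n}
    (h : Around χ S (blockOf π S v) a c) :
    stateMoment P χ π S X = stateMoment P χ π (S \ blockOf π S v)
      (X.before P χ c (P.E (orderedProd (blockOf π S v) X.T))) := by
  rw [stateMoment_eq_after hπ hS hv hX h,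
    balanced P hπ _ X hX _ _ (h.consecutive hv.blockOf_nonempty)]

theorem IsLowest.of_subset {v : Fin n} (hv : IsLowest π S v) (hVS : V ⊆ S)
    (hV : ∀ i ∈ S, ∀ j ∈ V, π.r i j → i ∈ V) (hvV : v ∈ V) : IsLowest π V v :=
  ⟨hvV, fun j hj => hv.le j (hVS hj), fun j hj hr => by
    obtain ⟨i, hi, hij, hlt⟩ := hv.exists_lt j (hVS hj) hr
    exact ⟨i, hV i hi j hj hij, hij, hlt⟩⟩

theorem blockOf_eq_of_subset {v : Fin n} (hVS : V ⊆ S)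
    (hV : ∀ i ∈ S, ∀ j ∈ V, π.r i j → i ∈ V) (hvV : v ∈ V) : blockOf π V v = blockOf π S v := by
  ext i
  rw [mem_blockOf, mem_blockOf]
  exact ⟨fun h => ⟨hVS h.1, h.2⟩, fun h => ⟨hV i h.1 v hvV (π.iseqv.symm h.2), h.2⟩⟩

theorem momentOn_after {a : Site n} (h : ∀ k ∈ V, a ≠ .node k) (X : State B A n) (b : B) :
    momentOn P χ π V (X.after P χ a b).T = momentOn P χ π V X.T :=
  momentOn_congr P fun k hk => X.after_T_of_ne (h k hk) b

theorem momentOn_before {a : Site n} (h : ∀ k ∈ V, a ≠ .node k) (X : State B A n) (b : B) :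
    momentOn P χ π V (X.before P χ a b).T = momentOn P χ π V X.T :=
  momentOn_congr P fun k hk => X.before_T_of_ne (h k hk) b

/-- A union `V` of blocks that is an interval for `≺_χ` may be replaced by its value, inserted
at the place of `V`. -/
theorem stateMoment_remove (hπ : NonCrossing χ π) (hVS : V ⊆ S) (hVne : V.Nonempty)
    (hWne : (S \ V).Nonempty) (hV : ∀ i ∈ S, ∀ j ∈ V, π.r i j → i ∈ V) {a c : Site n}
    (h : Around χ S V a c) {X : State B A n} (hX : X.Adapted P χ) :
    stateMoment P χ π S X =
      stateMoment P χ π (S \ V) (X.after P χ a (momentOn P χ π V X.T)) := by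
  induction hc : S.card using Nat.strong_induction_on generalizing S V X a c with
  | _ N ih =>
  subst hc
  obtain ⟨w, hw⟩ := hVne
  have hS : ¬ OneBlock π S := fun hS => by
    obtain ⟨u, hu⟩ := hWne
    rw [Finset.mem_sdiff] at hu
    exact hu.2 (hV u hu.1 w hw (hS u hu.1 w (hVS hw)))
  obtain ⟨v, hv⟩ := exists_isLowest hS
  obtain ⟨a', c', hac⟩ := hv.exists_around hπ
  have hA : ∀ {Y : State B A n}, Y.Adapted P χ → _ := fun hY => stateMoment_eq_after hπ hS hv hY hac
  have hC : ∀ {Y : State B A n}, Y.Adapted P χ → _ := fun hY =>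
    stateMoment_eq_before hπ hS hv hY hac
  have hcard := hv.card_lt
  have hvU : v ∈ blockOf π S v := mem_blockOf.2 ⟨hv.mem, π.iseqv.refl v⟩
  have hUS : blockOf π S v ⊆ S := fun i hi => (mem_blockOf.1 hi).1
  have hU : ∀ i ∈ S, ∀ j ∈ blockOf π S v, π.r i j → i ∈ blockOf π S v := fun i hi j hj hij =>
    mem_blockOf.2 ⟨hi, π.iseqv.trans (mem_blockOf.1 hj).2 (π.iseqv.symm hij)⟩
  have hUne := hv.blockOf_nonempty
  have hcons' := hac.consecutive hUne
  have hcons := h.consecutive ⟨w, hw⟩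
  -- The lowest block lies either inside `V` or inside its complement, and is removed there and in
  -- `S`.
  by_cases hvV : v ∈ V
  · have hvL := hv.of_subset hVS hV hvV
    have hUV := blockOf_eq_of_subset hVS hV hvV
    by_cases hVO : OneBlock π V
    · have hVU : blockOf π S v = V := by rw [← hUV, hVO.blockOf_eq hvV]
      rw [momentOn_of_oneBlock P χ hVO]
      rw [← hVU] at h ⊢
      exact stateMoment_eq_after hπ hS hv hX h
    obtain ⟨a'', c'', hac'⟩ := hvL.exists_around hπ
    obtain ⟨y, hy⟩ := sdiff_blockOf_nonempty' hVO v
    rw [hUV] at hy hac'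
    have hy' := Finset.mem_sdiff.1 hy
    have hUV' : blockOf π S v ⊆ V := hUV ▸ fun i hi => (mem_blockOf.1 hi).1
    have hsd : (S \ blockOf π S v) \ (V \ blockOf π S v) = S \ V := by
      ext i
      simp only [Finset.mem_sdiff]
      have := @hUV' i
      tauto
    have hV' : ∀ i ∈ S \ blockOf π S v, ∀ j ∈ V \ blockOf π S v, π.r i j →
        i ∈ V \ blockOf π S v := by
      intro i hi j hj hij
      rw [Finset.mem_sdiff] at hi hj ⊢
      exact ⟨hV i hi.1 j hj.1 hij, hi.2⟩
    have hAr : Around χ (S \ blockOf π S v) (V \ blockOf π S v) a c :=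
      ⟨hsd ▸ h.left_isIn, hsd ▸ h.right_isIn, fun k hk => h.left_lt k (Finset.mem_sdiff.1 hk).1,
        fun k hk => h.lt_right k (Finset.mem_sdiff.1 hk).1, hsd ▸ h.not_between⟩
    have hIH : ∀ {Y : State B A n}, Y.Adapted P χ → _ := fun hY =>
      ih _ hcard (Finset.sdiff_subset_sdiff hVS subset_rfl) ⟨y, hy⟩ (hsd ▸ hWne) hV' hAr hY rfl
    have hcons'' := hac'.consecutive hUne
    have hX₁ : (State.mk 1 1 X.T : State B A n).Adapted P χ := hX
    have hnode : ∀ i, i ∈ S → a.rank χ < pos χ i + 1 → pos χ i + 1 < c.rank χ → i ∈ V := by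
      intro i hi h₁ h₂
      by_contra hiV
      have := h.not_between i (Finset.mem_sdiff.2 ⟨hi, hiV⟩)
      omega
    have h₁ := h.left_lt y hy'.1
    have h₂ := h.lt_right y hy'.1
    have h₃ := h.left_lt v hvV
    have h₄ := h.lt_right v hvV
    have h₅ := hac.left_lt v hvU
    have h₆ := hac.lt_right v hvU
    have h₇ := hac'.left_lt v hvU
    have h₈ := hac'.lt_right v hvU
    have hsub : V \ blockOf π S v ⊆ S \ blockOf π S v := Finset.sdiff_subset_sdiff hVS subset_rfl
    -- A further node `y` of `V` lies before or after the lowest block. The neighbour of the block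
    -- on that side is not beyond `y`, so it belongs to `V` and is also the neighbour within `V`.
    -- Attached there, the value of the block enters only through the value of `V`.
    rcases hac.not_between y (Finset.mem_sdiff.2 ⟨hVS hy'.1, hy'.2⟩) with hya | hyc
    · obtain ⟨i, rfl⟩ : ∃ i, a' = .node i := by
        cases a' with
        | bot => simp at hya
        | node i => exact ⟨i, rfl⟩
        | top => exact absurd rfl (hac.left_ne_top hUne)
      simp only [Site.rank_node] at hya h₅
      have hiU := Finset.mem_sdiff.1 hac.left_isIn
      have hiV := hnode i hiU.1 (by omega) (by omega)
      obtain rfl : a'' = .node i := by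
        apply Site.rank_injective (χ := χ)
        have h₉ := hcons'.isIn_cases (hac'.left_isIn.mono hsub)
        have h₁₀ := hac'.not_between i (Finset.mem_sdiff.2 ⟨hiV, hiU.2⟩)
        simp only [Site.rank_node] at h₉ ⊢
        omega
      have hm := stateMoment_eq_after hπ hVO hvL hX₁ (hUV.symm ▸ hac')
      rw [hUV] at hm
      simp only [stateMoment, State.after, one_mul, mul_one] at hm
      have hiW : i ∉ S \ V := fun hi => (Finset.mem_sdiff.1 hi).2 hiV
      rw [hA hX, hIH (hX.after _ _), hsd, hm,
        State.after_comm _ (h.left_isIn.ne_node hiW).symm, stateMoment_after_node hiW]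
      rfl
    · obtain ⟨i, rfl⟩ : ∃ i, c' = .node i := by
        cases c' with
        | bot => exact absurd rfl (hac.right_ne_bot hUne)
        | node i => exact ⟨i, rfl⟩
        | top =>
          have := pos_lt χ y
          simp at hyc
          omega
      simp only [Site.rank_node] at hyc h₆
      have hiU := Finset.mem_sdiff.1 hac.right_isIn
      have hiV := hnode i hiU.1 (by omega) (by omega)
      obtain rfl : c'' = .node i := by
        apply Site.rank_injective (χ := χ)
        have h₉ := hcons'.isIn_cases (hac'.right_isIn.mono hsub)
        have h₁₀ := hac'.not_between i (Finset.mem_sdiff.2 ⟨hiV, hiU.2⟩)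
        simp only [Site.rank_node] at h₉ ⊢
        omega
      have hm := stateMoment_eq_before hπ hVO hvL hX₁ (hUV.symm ▸ hac')
      rw [hUV] at hm
      simp only [stateMoment, State.before, one_mul, mul_one] at hm
      have hiW : i ∉ S \ V := fun hi => (Finset.mem_sdiff.1 hi).2 hiV
      rw [hC hX, hIH (hX.before _ _), hsd, hm,
        ← State.after_before_comm _ (h.left_isIn.ne_node hiW), stateMoment_before_node hiW]
      rfl
  · have hvW : v ∈ S \ V := Finset.mem_sdiff.2 ⟨hv.mem, hvV⟩
    have hWS : S \ V ⊆ S := Finset.sdiff_subset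
    have hWcl : ∀ i ∈ S, ∀ j ∈ S \ V, π.r i j → i ∈ S \ V := fun i hi j hj hij => by
      rw [Finset.mem_sdiff] at hj ⊢
      exact ⟨hi, fun hiV => hj.2 (hV j hj.1 i hiV (π.iseqv.symm hij))⟩
    have hvL := hv.of_subset hWS hWcl hvW
    have hUW := blockOf_eq_of_subset hWS hWcl hvW
    have hUW' : blockOf π S v ⊆ S \ V := hUW ▸ fun i hi => (mem_blockOf.1 hi).1
    have hdisj : ∀ i ∈ blockOf π S v, i ∉ V := fun i hi => (Finset.mem_sdiff.1 (hUW' hi)).2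
    have hVK : V ⊆ S \ blockOf π S v := fun i hi =>
      Finset.mem_sdiff.2 ⟨hVS hi, fun hiU => hdisj i hiU hi⟩
    have hsd : (S \ blockOf π S v) \ V = (S \ V) \ blockOf π S v := sdiff_right_comm _ _ _
    have hVcl : ∀ i ∈ S \ blockOf π S v, ∀ j ∈ V, π.r i j → i ∈ V := fun i hi j hj =>
      hV i (Finset.sdiff_subset hi) j hj
    have hIH : ¬ OneBlock π (S \ V) → ∀ {b d : Site n}, Around χ (S \ blockOf π S v) V b d →
        ∀ {Y : State B A n}, Y.Adapted P χ → _ := fun hW _ _ hAr _ hY =>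
      ih _ hcard hVK ⟨w, hw⟩ (hsd ▸ hUW ▸ sdiff_blockOf_nonempty' hW v) hVcl hAr hY rfl
    have hAW : ¬ OneBlock π (S \ V) → ∀ {b d : Site n}, Around χ (S \ V) (blockOf π S v) b d →
        ∀ {Y : State B A n}, Y.Adapted P χ → stateMoment P χ π (S \ V) Y =
          stateMoment P χ π ((S \ V) \ blockOf π S v)
            (Y.after P χ b (P.E (orderedProd (blockOf π S v) Y.T))) := fun hW _ _ hAr _ hY => by
      have := stateMoment_eq_after hπ hW hvL hY (hUW.symm ▸ hAr)
      rwa [hUW] at this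
    have hCW : ¬ OneBlock π (S \ V) → ∀ {b d : Site n}, Around χ (S \ V) (blockOf π S v) b d →
        ∀ {Y : State B A n}, Y.Adapted P χ → stateMoment P χ π (S \ V) Y =
          stateMoment P χ π ((S \ V) \ blockOf π S v)
            (Y.before P χ d (P.E (orderedProd (blockOf π S v) Y.T))) := fun hW _ _ hAr _ hY => by
      have := stateMoment_eq_before hπ hW hvL hY (hUW.symm ▸ hAr)
      rwa [hUW] at this
    have hWU : OneBlock π (S \ V) → S \ V = blockOf π S v := fun hW => by
      rw [← hUW, hW.blockOf_eq hvW]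
    have hUV : OneBlock π (S \ V) → S \ blockOf π S v = V := fun hW => by
      rw [← hWU hW, Finset.sdiff_sdiff_eq_self hVS]
    have hwU : w ∈ S \ blockOf π S v := hVK hw
    have h₁ := h.left_lt w hw
    have h₂ := h.lt_right w hw
    have h₃ := hac.left_lt v hvU
    have h₄ := hac.lt_right v hvU
    have h₅ := hac.not_between w hwU
    have h₆ := h.not_between v hvW
    have hKsub : (S \ blockOf π S v) \ V ⊆ S \ blockOf π S v := Finset.sdiff_subset
    have hrange : ∀ k ∈ (S \ V) \ blockOf π S v, k ∈ S \ V ∧ k ∈ S \ blockOf π S v := by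
      intro k hk
      simp only [Finset.mem_sdiff] at hk ⊢
      tauto
    -- If `a` is a node of the lowest block, this block lies immediately before `V`. Its value
    -- followed by that of `V` goes after `a'`, in whichever order the two are removed.
    rcases a.exists_or_forall_ne (blockOf π S v) with ⟨i, hi, rfl⟩ | ha
    · have h₇ := hac.left_lt i hi
      have h₈ := hac.lt_right i hi
      simp only [Site.rank_node] at h₁ h₂ h₆
      have ha'V : ∀ k ∈ V, a' ≠ .node k := by
        rintro k hk rfl
        have := h.left_lt k hk
        simp only [Site.rank_node] at h₇ this
        omega
      have hUc : ∀ k ∈ blockOf π S v, pos χ k + 1 < c.rank χ := by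
        intro k hk
        have h₉ := h.not_between k (hUW' hk)
        have h₁₀ := hac.lt_right k hk
        simp only [Site.rank_node] at h₉
        omega
      have hcU : ∀ k ∈ blockOf π S v, c ≠ .node k := by
        rintro k hk rfl
        exact lt_irrefl _ (hUc k hk)
      -- If nothing else remains, the neighbours are the ends, and the two values are multiplied
      -- through the outer factors.
      by_cases hW : OneBlock π (S \ V)
      · have ha' : a' = .bot := by
          have h₉ := hac.left_isIn
          rw [hUV hW] at h₉
          cases a' with
          | bot => rfl
          | node k => exact absurd rfl (ha'V k h₉)
          | top => exact absurd rfl (hac.left_ne_top hUne)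
        have hct : c = .top := by
          have h₉ := h.right_isIn
          rw [hWU hW] at h₉
          cases c with
          | bot => exact absurd rfl (h.right_ne_bot ⟨w, hw⟩)
          | node k => exact absurd rfl (hcU k h₉)
          | top => rfl
        subst ha' hct
        rw [balanced P hπ _ X hX _ _ hcons, hA hX, hUV hW, hWU hW, stateMoment, stateMoment,
          momentOn_of_oneBlock P χ (S := blockOf π S v) (hWU hW ▸ hW)]
        simp only [State.after, State.before, mul_assoc]
      · have hAr : Around χ (S \ blockOf π S v) V a' c := by
          refine ⟨hac.left_isIn.sdiff ha'V, hsd ▸ h.right_isIn.sdiff hcU, fun k hk => ?_,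
            h.lt_right, fun k hk => ?_⟩
          · have := h.left_lt k hk
            simp only [Site.rank_node] at this
            omega
          · obtain ⟨hk₁, hk₂⟩ := hrange k (hsd ▸ hk)
            have h₉ := h.not_between k hk₁
            have h₁₀ := hac.not_between k hk₂
            simp only [Site.rank_node] at h₉
            omega
        have hAr' : Around χ (S \ V) (blockOf π S v) a' c :=
          ⟨hsd ▸ hAr.left_isIn, h.right_isIn.sdiff hcU, hac.left_lt, hUc, hsd ▸ hAr.not_between⟩
        have hi' : i ∉ (S \ V) \ blockOf π S v := fun hi' => (Finset.mem_sdiff.1 hi').2 hi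
        rw [hA hX, hIH hW hAr (hX.after _ _), hAW hW hAr' (hX.after _ _), momentOn_after ha'V,
          E_after_node_of_top hX (hcons.to_top hUW' hi hUc), hsd, State.after_after,
          State.after_comm X (hac.left_isIn.ne_node fun hiK => (Finset.mem_sdiff.1 hiK).2 hi).symm,
          stateMoment_after_node hi']
    rcases c.exists_or_forall_ne (blockOf π S v) with ⟨i, hi, rfl⟩ | hcU
    · have h₇ := hac.left_lt i hi
      have h₈ := hac.lt_right i hi
      simp only [Site.rank_node] at h₁ h₂ h₆
      have hc'V : ∀ k ∈ V, c' ≠ .node k := by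
        rintro k hk rfl
        have := h.lt_right k hk
        simp only [Site.rank_node] at h₈ this
        omega
      have hUa : ∀ k ∈ blockOf π S v, a.rank χ < pos χ k + 1 := by
        intro k hk
        have h₉ := h.not_between k (hUW' hk)
        have h₁₀ := hac.left_lt k hk
        simp only [Site.rank_node] at h₉
        omega
      by_cases hW : OneBlock π (S \ V)
      · have hc' : c' = .top := by
          have h₉ := hac.right_isIn
          rw [hUV hW] at h₉
          cases c' with
          | bot => exact absurd rfl (hac.right_ne_bot hUne)
          | node k => exact absurd rfl (hc'V k h₉)
          | top => rfl
        have hab : a = .bot := by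
          have h₉ := h.left_isIn
          rw [hWU hW] at h₉
          cases a with
          | bot => rfl
          | node k => exact absurd rfl (ha k h₉)
          | top => exact absurd rfl (h.left_ne_top ⟨w, hw⟩)
        subst hc' hab
        rw [hC hX, hUV hW, hWU hW, stateMoment, stateMoment,
          momentOn_of_oneBlock P χ (S := blockOf π S v) (hWU hW ▸ hW)]
        simp only [State.after, State.before, mul_assoc]
      · have hAr : Around χ (S \ blockOf π S v) V a c' := by
          refine ⟨hsd ▸ h.left_isIn.sdiff ha, hac.right_isIn.sdiff hc'V, h.left_lt,
            fun k hk => ?_, fun k hk => ?_⟩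
          · have := h.lt_right k hk
            simp only [Site.rank_node] at this
            omega
          · obtain ⟨hk₁, hk₂⟩ := hrange k (hsd ▸ hk)
            have h₉ := h.not_between k hk₁
            have h₁₀ := hac.not_between k hk₂
            simp only [Site.rank_node] at h₉
            omega
        have hAr' : Around χ (S \ V) (blockOf π S v) a c' :=
          ⟨h.left_isIn.sdiff ha, hsd ▸ hAr.right_isIn, hUa, hac.lt_right, hsd ▸ hAr.not_between⟩
        have hi' : i ∉ (S \ V) \ blockOf π S v := fun hi' => (Finset.mem_sdiff.1 hi').2 hi
        rw [hC hX, hIH hW hAr (hX.before _ _),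
          balanced P hπ _ _ (hX.before _ _) _ _ (hAr.consecutive ⟨w, hw⟩),
          balanced P hπ _ X hX _ _ hcons, hCW hW hAr' (hX.before _ _), momentOn_before hc'V,
          E_before_node_of_bot hX (hcons.of_bot hUW' hi hUa), hsd, State.before_before,
          State.before_comm X
            (hac.right_isIn.ne_node fun hiK => (Finset.mem_sdiff.1 hiK).2 hi).symm,
          stateMoment_before_node hi']
    · have haK := (h.left_isIn.mono hWS).sdiff ha
      have hcK := (h.right_isIn.mono hWS).sdiff hcU
      have h₇ := hcons'.isIn_cases haK
      have h₈ := hcons'.isIn_cases hcK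
      have hW : ¬ OneBlock π (S \ V) := by
        intro hW
        have hab := h.left_isIn
        have hct := h.right_isIn
        rw [hWU hW] at hab hct
        cases a with
        | bot => cases c with
          | bot => exact absurd rfl (h.right_ne_bot ⟨w, hw⟩)
          | node k => exact absurd rfl (hcU k hct)
          | top =>
            have := pos_lt χ v
            simp at h₆
            omega
        | node k => exact absurd rfl (ha k hab)
        | top => exact absurd rfl (h.left_ne_top ⟨w, hw⟩)
      have ha'V : ∀ k ∈ V, a' ≠ .node k := by
        rintro k hk rfl
        have h₉ := h.left_lt k hk
        have h₁₀ := h.lt_right k hk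
        simp only [Site.rank_node] at h₃ h₈
        omega
      have hc'V : ∀ k ∈ V, c' ≠ .node k := by
        rintro k hk rfl
        have h₉ := h.left_lt k hk
        have h₁₀ := h.lt_right k hk
        simp only [Site.rank_node] at h₄ h₇
        omega
      -- A common left neighbour would make `V` and the lowest block adjacent, against the
      -- assumption that neither `a` nor `c` lies in that block. At distinct sites the two
      -- insertions commute.
      have hne : a ≠ a' := by
        rintro rfl
        omega
      have hAr : Around χ (S \ blockOf π S v) V a c :=
        ⟨hsd ▸ h.left_isIn.sdiff ha, hsd ▸ h.right_isIn.sdiff hcU, h.left_lt, h.lt_right,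
          fun k hk => h.not_between k (hrange k (hsd ▸ hk)).1⟩
      have hAr' : Around χ (S \ V) (blockOf π S v) a' c' :=
        ⟨hsd ▸ hac.left_isIn.sdiff ha'V, hsd ▸ hac.right_isIn.sdiff hc'V, hac.left_lt,
          hac.lt_right, fun k hk => hac.not_between k (hrange k hk).2⟩
      rw [hA hX, hIH hW hAr (hX.after _ _), hAW hW hAr' (hX.after _ _), momentOn_after ha'V,
        orderedProd_after ha, hsd, State.after_comm X hne]

end Removal

/-! ### Restriction to a subset of the nodes -/

section Transport

variable {m n : ℕ} (e : Fin m ↪o Fin n) {χ : Fin n → Side} {π : Setoid (Fin n)}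
  {S : Finset (Fin m)}

/-- Positions of right nodes depend on the total number of nodes, so an embedding preserves only
their order. -/
theorem pos_comp_le_iff (a b : Fin m) : pos (χ ∘ e) a ≤ pos (χ ∘ e) b ↔
    pos χ (e a) ≤ pos χ (e b) := by
  have h : a.val ≤ b.val ↔ (e a).val ≤ (e b).val := (e.le_iff_le (a := a) (b := b)).symm
  have h' : b.val ≤ a.val ↔ (e b).val ≤ (e a).val := (e.le_iff_le (a := b) (b := a)).symm
  have h₁ := a.isLt
  have h₂ := b.isLt
  have h₃ := (e a).isLt
  have h₄ := (e b).isLt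
  rcases (χ (e a)).left_or_right with ha | ha <;> rcases (χ (e b)).left_or_right with hb | hb
  · rw [pos_left ha, pos_left hb, pos_left (χ := χ ∘ e) ha, pos_left (χ := χ ∘ e) hb]
    omega
  · rw [pos_left ha, pos_right hb, pos_left (χ := χ ∘ e) ha, pos_right (χ := χ ∘ e) hb]
    omega
  · rw [pos_right ha, pos_left hb, pos_right (χ := χ ∘ e) ha, pos_left (χ := χ ∘ e) hb]
    omega
  · rw [pos_right ha, pos_right hb, pos_right (χ := χ ∘ e) ha, pos_right (χ := χ ∘ e) hb]
    omega

theorem seenFirst_comp_iff (s : Side) (a b : Fin m) :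
    SeenFirst (χ ∘ e) s a b ↔ SeenFirst χ s (e a) (e b) := by
  cases s
  · exact pos_comp_le_iff e a b
  · exact pos_comp_le_iff e b a

theorem blockOf_map (v : Fin m) : blockOf π (S.map e.toEmbedding) (e v) =
    (blockOf (Setoid.comap e π) S v).map e.toEmbedding := by
  ext i
  simp only [mem_blockOf, Finset.mem_map, RelEmbedding.coe_toEmbedding]
  constructor
  · rintro ⟨⟨j, hj, rfl⟩, hr⟩
    exact ⟨j, ⟨hj, hr⟩, rfl⟩
  · rintro ⟨j, ⟨hj, hr⟩, rfl⟩
    exact ⟨⟨j, hj, rfl⟩, hr⟩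

theorem oneBlock_map : OneBlock π (S.map e.toEmbedding) ↔ OneBlock (Setoid.comap e π) S := by
  simp only [OneBlock, Finset.forall_mem_map]
  rfl

theorem IsLowest.map {v : Fin m} (h : IsLowest (Setoid.comap e π) S v) :
    IsLowest π (S.map e.toEmbedding) (e v) := by
  refine ⟨Finset.mem_map_of_mem e.toEmbedding h.mem, ?_, ?_⟩
  · refine (Finset.forall_mem_map (f := e.toEmbedding)).2 fun j hj hr => ?_
    exact e.le_iff_le.2 (h.le j hj hr)
  · refine (Finset.forall_mem_map (f := e.toEmbedding)).2 fun j hj hr => ?_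
    obtain ⟨i, hi, hij, hlt⟩ := h.exists_lt j hj hr
    exact ⟨e i, Finset.mem_map_of_mem e.toEmbedding hi, hij, e.lt_iff_lt.2 hlt⟩

theorem IsInsertion.map {v a k : Fin m} (h : IsInsertion (χ ∘ e) (Setoid.comap e π) S v a k) :
    IsInsertion χ π (S.map e.toEmbedding) (e v) (e a) (e k) := by
  refine ⟨Finset.mem_map_of_mem e.toEmbedding h.mem, e.lt_iff_lt.2 h.lt, h.not_rel, ?_,
    Finset.mem_map_of_mem e.toEmbedding h.mem', e.lt_iff_lt.2 h.lt', h.rel, ?_⟩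
  · refine (Finset.forall_mem_map (f := e.toEmbedding)).2 fun j hj hlt hr => ?_
    exact (seenFirst_comp_iff e _ a j).1 (h.first j hj (e.lt_iff_lt.1 hlt) hr)
  · refine (Finset.forall_mem_map (f := e.toEmbedding)).2 fun j hj hlt hr => ?_
    exact e.le_iff_le.2 (h.le j hj (e.lt_iff_lt.1 hlt) hr)

variable {B A : Type*} [Ring B] [Algebra ℂ B] [Ring A] [Algebra ℂ A] (P : BBProbSpace B A)

/-- The properties speak of restricted tuples renumbered from the start, whereas the inductions run
over subsets of a fixed `Fin n`. The recursion uses only the order of the nodes, the sides and the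
blocks, all of which an increasing renumbering respects. -/
theorem momentOn_map (T : Fin n → A) : momentOn P χ π (S.map e.toEmbedding) T =
    momentOn P (χ ∘ e) (Setoid.comap e π) S (T ∘ e) := by
  induction hc : S.card using Nat.strong_induction_on generalizing S T with
  | _ N ih =>
  subst hc
  by_cases hS : OneBlock (Setoid.comap e π) S
  · rw [momentOn_of_oneBlock P _ hS, momentOn_of_oneBlock P _ ((oneBlock_map e).2 hS),
      orderedProd_map]
  have hS' := mt (oneBlock_map e).1 hS
  obtain ⟨v, k, hv, hk, hstep⟩ := exists_momentOn_step P (χ ∘ e) hS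
  have hK : S.map e.toEmbedding \ blockOf π (S.map e.toEmbedding) (e v) =
      (S \ blockOf (Setoid.comap e π) S v).map e.toEmbedding := by
    rw [blockOf_map, Finset.map_sdiff]
  rw [mem_sdiff_blockOf] at hk
  rcases hstep with ⟨hlast, hmax, hstep⟩ | ⟨⟨a, hins⟩, hstep⟩
  · rw [hstep, momentOn_of_last (k := e k) P hS' (hv.map e)
      ((Finset.forall_mem_map (f := e.toEmbedding)).2 fun j hj hlt =>
        hlast j hj (e.lt_iff_lt.1 hlt))
      (Finset.mem_map_of_mem e.toEmbedding hk.1) hk.2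
      ((Finset.forall_mem_map (f := e.toEmbedding)).2 fun j hj hr =>
        e.le_iff_le.2 (hmax j hj hr)), hK, ih _ hv.card_lt _ rfl,
      Function.update_comp_eq_of_injective _ e.injective, blockOf_map, orderedProd_map]
    rfl
  · rw [hstep, momentOn_of_isInsertion P (hv.map e) (hins.map e), hK, ih _ hv.card_lt _ rfl,
      Function.update_comp_eq_of_injective _ e.injective, blockOf_map, orderedProd_map]
    rfl

end Transport

/-! ### Linearity -/

section Linearity

variable {B A : Type*} [Ring B] [Algebra ℂ B] [Ring A] [Algebra ℂ A] (P : BBProbSpace B A)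
  {n : ℕ} {χ : Fin n → Side} {π : Setoid (Fin n)} {S : Finset (Fin n)}

/-- `L` and `R` as linear maps. -/
def BBProbSpace.opLinear (s : Side) : B →ₗ[ℂ] A where
  toFun := P.op s
  map_add' b b' := by cases s <;> simp [BBProbSpace.op, TensorProduct.add_tmul,
    TensorProduct.tmul_add]
  map_smul' c b := by cases s <;> simp [BBProbSpace.op, ← TensorProduct.smul_tmul']

/-- Multiplication by the inserted factor from the right or from the left is bilinear in both cases,
so linearity can be proved without distinguishing them. -/
theorem exists_momentOn_step_linear (χ : Fin n → Side) (hS : ¬ OneBlock π S) :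
    ∃ v k, ∃ μ : A →ₗ[ℂ] A →ₗ[ℂ] A, IsLowest π S v ∧ k ∈ S \ blockOf π S v ∧
      ∀ T : Fin n → A, momentOn P χ π S T = momentOn P χ π (S \ blockOf π S v)
        (Function.update T k (μ (T k) (P.op (χ v) (P.E (orderedProd (blockOf π S v) T))))) := by
  obtain ⟨v, k, hv, hk, ⟨-, -, h⟩ | ⟨-, h⟩⟩ := exists_momentOn_step P χ hS
  · exact ⟨v, k, LinearMap.mul ℂ A, hv, hk, h⟩
  · exact ⟨v, k, (LinearMap.mul ℂ A).flip, hv, hk, h⟩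

theorem exists_E_orderedProd_update_eq {V : Finset (Fin n)} {k : Fin n} (hk : k ∈ V)
    (T : Fin n → A) :
    ∃ f : A →ₗ[ℂ] B, ∀ x, P.E (orderedProd V (Function.update T k x)) = f x :=
  ⟨P.E ∘ₗ LinearMap.mulRight ℂ (prodFrom V (k.val + 1) T) ∘ₗ
    LinearMap.mulLeft ℂ (prodBelow V k.val T), fun x => by rw [orderedProd_update hk]; rfl⟩

theorem exists_momentOn_update_eq {k : Fin n} (hk : k ∈ S) (T : Fin n → A) :
    ∃ f : A →ₗ[ℂ] B, ∀ x, momentOn P χ π S (Function.update T k x) = f x := by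
  induction hc : S.card using Nat.strong_induction_on generalizing S T k with
  | _ N ih =>
  subst hc
  by_cases hS : OneBlock π S
  · obtain ⟨f, hf⟩ := exists_E_orderedProd_update_eq P hk T
    exact ⟨f, fun x => by rw [momentOn_of_oneBlock P χ hS, hf]⟩
  obtain ⟨v, k', μ, hv, hk', hstep⟩ := exists_momentOn_step_linear P χ hS
  -- For `k` in the removed block, `x` reaches the remainder only through the inserted factor, which
  -- is linear in `x`. Otherwise the inserted factor is constant in `x`.
  by_cases hkV : k ∈ blockOf π S v
  · obtain ⟨g, hg⟩ := exists_E_orderedProd_update_eq P hkV T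
    obtain ⟨f, hf⟩ := ih _ hv.card_lt hk' T rfl
    have hne : ∀ i ∈ S \ blockOf π S v, i ≠ k := by
      rintro i hi rfl
      exact (Finset.mem_sdiff.1 hi).2 hkV
    refine ⟨f ∘ₗ μ (T k') ∘ₗ P.opLinear (χ v) ∘ₗ g, fun x => ?_⟩
    rw [hstep, hg, Function.update_of_ne (hne k' hk')]
    simp only [LinearMap.comp_apply]
    rw [← hf]
    refine momentOn_congr P fun i hi => ?_
    rcases eq_or_ne i k' with rfl | hik
    · simp only [Function.update_self]
      rfl
    · rw [Function.update_of_ne hik, Function.update_of_ne hik, Function.update_of_ne (hne i hi)]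
  · have hkK : k ∈ S \ blockOf π S v := Finset.mem_sdiff.2 ⟨hk, hkV⟩
    rcases eq_or_ne k' k with rfl | hne
    · obtain ⟨f, hf⟩ := ih _ hv.card_lt hk' T rfl
      refine ⟨f ∘ₗ μ.flip (P.op (χ v) (P.E (orderedProd (blockOf π S v) T))), fun x => ?_⟩
      rw [hstep, orderedProd_update_of_notMem hkV, Function.update_self, Function.update_idem, hf]
      rfl
    · obtain ⟨f, hf⟩ := ih _ hv.card_lt hkK (Function.update T k'
        (μ (T k') (P.op (χ v) (P.E (orderedProd (blockOf π S v) T))))) rfl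
      refine ⟨f, fun x => ?_⟩
      rw [hstep, orderedProd_update_of_notMem hkV, Function.update_of_ne hne,
        Function.update_comm hne.symm, hf]

end Linearity

/-! ### Bi-multiplicativity -/

section Main

variable {B A : Type*} [Ring B] [Algebra ℂ B] [Ring A] [Algebra ℂ A] {P : BBProbSpace B A}
  {n : ℕ} {χ : Fin n → Side}

theorem BNC.nonCrossing (π : BNC χ) : NonCrossing χ π.rel :=
  fun u₁ v₁ u₂ v₂ h₁ h₂ h₃ => π.noncrossing u₁ v₁ u₂ v₂ (prec_iff.2 h₁) (prec_iff.2 h₂)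
    (prec_iff.2 h₃)

/-- The state of a tuple, with trivial outer factors. -/
def Tuple.state (T : Tuple P χ) : State B A n := ⟨1, 1, fun k => T k⟩

theorem Tuple.state_adapted (T : Tuple P χ) : T.state.Adapted P χ := fun k => (T k).2

theorem stateMoment_state (π : Setoid (Fin n)) (S : Finset (Fin n)) (T : Tuple P χ) :
    stateMoment P χ π S T.state = momentOn P χ π S fun k => (T k : A) := by
  simp [stateMoment, Tuple.state]

theorem momentFunction_eq (π : BNC χ) (T : Tuple P χ) :
    momentFunction P χ π T = stateMoment P χ π.rel Finset.univ T.state := by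
  rw [stateMoment_state]
  rfl

theorem momentFunction_restrict (π : BNC χ) (T : Tuple P χ) (S : Finset (Fin n)) :
    momentFunction P (χ ∘ enum S) (π.restrict S) (T.restrict S) =
      stateMoment P χ π.rel S T.state := by
  rw [stateMoment_state]
  have h := momentOn_map (S.orderEmbOfFin rfl) P (χ := χ) (π := π.rel) (S := Finset.univ)
    fun k => (T k : A)
  rw [Finset.map_orderEmbOfFin_univ] at h
  rw [h]
  rfl

theorem Tuple.coe_update (T : Tuple P χ) (k : Fin n) (x : P.face (χ k)) :
    (fun j => ((Function.update T k x : Tuple P χ) j : A)) =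
      Function.update (fun j => (T j : A)) k x := by
  funext j
  rcases eq_or_ne j k with rfl | h
  · simp
  · simp [h]

theorem Tuple.state_update (T : Tuple P χ) (k : Fin n) (x : P.face (χ k)) :
    Tuple.state (Function.update T k x) =
      ⟨1, 1, Function.update (fun j => (T j : A)) k x⟩ := by
  rw [Tuple.state, Tuple.coe_update]

/-- The reading order runs down the left side and up the right side, so multiplication from the
right is "after" for a left node and "before" for a right node; multiplication from the left is the
reverse. -/
theorem Tuple.state_mulRight_of_left (T : Tuple P χ) {k : Fin n} (hk : χ k = .left) (b : B) :
    (T.mulRight k b).state = T.state.after P χ (.node k) b := by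
  rw [Tuple.mulRight, Tuple.state_update]
  simp [State.after, Tuple.state, BBProbSpace.opFace, hk, mulAfter]

theorem Tuple.state_mulRight_of_right (T : Tuple P χ) {k : Fin n} (hk : χ k = .right) (b : B) :
    (T.mulRight k b).state = T.state.before P χ (.node k) b := by
  rw [Tuple.mulRight, Tuple.state_update]
  simp [State.before, Tuple.state, BBProbSpace.opFace, hk, mulBefore]

theorem Tuple.state_mulLeft_of_left (T : Tuple P χ) {k : Fin n} (hk : χ k = .left) (b : B) :
    (T.mulLeft k b).state = T.state.before P χ (.node k) b := by
  rw [Tuple.mulLeft, Tuple.state_update]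
  simp [State.before, Tuple.state, BBProbSpace.opFace, hk, mulBefore]

theorem Tuple.state_mulLeft_of_right (T : Tuple P χ) {k : Fin n} (hk : χ k = .right) (b : B) :
    (T.mulLeft k b).state = T.state.after P χ (.node k) b := by
  rw [Tuple.mulLeft, Tuple.state_update]
  simp [State.after, Tuple.state, BBProbSpace.opFace, hk, mulAfter]

theorem stateMoment_before_top (π : Setoid (Fin n)) (S : Finset (Fin n)) (T : Tuple P χ) (b : B) :
    stateMoment P χ π S (T.state.before P χ .top b) = stateMoment P χ π S T.state * b := by
  simp [stateMoment, State.before, Tuple.state]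

theorem stateMoment_after_bot (π : Setoid (Fin n)) (S : Finset (Fin n)) (T : Tuple P χ) (b : B) :
    stateMoment P χ π S (T.state.after P χ .bot b) = b * stateMoment P χ π S T.state := by
  simp [stateMoment, State.after, Tuple.state]

theorem Side.eq_right_of_ne_left {s : Side} (h : s ≠ .left) : s = .right :=
  s.left_or_right.resolve_left h

theorem Side.eq_left_of_ne_right {s : Side} (h : s ≠ .right) : s = .left :=
  s.left_or_right.resolve_right h

/-! ### The four properties of the moment function -/

theorem consecutive_univ_nodes {i j : Fin n} (hlt : pos χ i < pos χ j)
    (h : ∀ k, pos χ k ≤ pos χ i ∨ pos χ j ≤ pos χ k) :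
    Consecutive χ Finset.univ (.node i) (.node j) :=
  ⟨Finset.mem_univ i, Finset.mem_univ j, Nat.succ_lt_succ hlt,
    fun k _ => (h k).imp Nat.succ_le_succ Nat.succ_le_succ⟩

theorem consecutive_univ_top {i : Fin n} (h : ∀ k, pos χ k ≤ pos χ i) :
    Consecutive χ Finset.univ (.node i) .top :=
  ⟨Finset.mem_univ i, trivial, by have := pos_lt χ i; simp; omega,
    fun k _ => Or.inl (Nat.succ_le_succ (h k))⟩

theorem consecutive_univ_bot {j : Fin n} (h : ∀ k, pos χ j ≤ pos χ k) :
    Consecutive χ Finset.univ .bot (.node j) :=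
  ⟨trivial, Finset.mem_univ j, by simp, fun k _ => Or.inr (Nat.succ_le_succ (h k))⟩

/-- The last node is the innermost on its side. Across the turning point of `≺_χ` its neighbour is
the lowest node `q` of the other side, or an end if that side is empty. -/
theorem momentFunction_propertyI (P : BBProbSpace B A) : PropertyI (momentFunction P) := by
  intro n χ T b
  have hbal := balanced P (BNC.one χ).nonCrossing Finset.univ T.state T.state_adapted
  have hlast := Fin.val_last n
  simp only [momentFunction_eq]
  refine ⟨fun q hq => ?_, fun hempty => ⟨fun hs => ?_, fun hs => ?_⟩⟩
  · have hmax : ∀ k, χ k ≠ χ (Fin.last n) → k.val ≤ q.val := fun k hk => hq.2 hk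
    rcases (χ (Fin.last n)).left_or_right with hs | hs
    · have hqs := Side.eq_right_of_ne_left (hs ▸ hq.1)
      rw [T.state_mulRight_of_left hs, T.state_mulRight_of_right hqs]
      refine hbal _ _ (consecutive_univ_nodes ?_ fun k => ?_) b
      · rw [pos_left hs, pos_right hqs]
        have := q.isLt
        omega
      · rw [pos_left hs, pos_right hqs]
        have := pos_cases χ k
        by_cases hk : χ k = χ (Fin.last n)
        · rw [hs] at hk
          rw [pos_left hk]
          omega
        · have := hmax k hk
          rw [pos_right (Side.eq_right_of_ne_left (hs ▸ hk))]
          omega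
    · have hqs := Side.eq_left_of_ne_right (hs ▸ hq.1)
      rw [T.state_mulRight_of_right hs, T.state_mulRight_of_left hqs]
      refine (hbal _ _ (consecutive_univ_nodes ?_ fun k => ?_) b).symm
      · rw [pos_left hqs, pos_right hs]
        have := q.isLt
        have : q.val ≠ n := fun e => hq.1 (by rw [show q = Fin.last n from Fin.ext e])
        omega
      · rw [pos_left hqs, pos_right hs]
        by_cases hk : χ k = χ (Fin.last n)
        · rw [hs] at hk
          rw [pos_right hk]
          omega
        · have := hmax k hk
          rw [pos_left (Side.eq_left_of_ne_right (hs ▸ hk))]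
          omega
  · rw [T.state_mulRight_of_left hs, hbal _ _ (consecutive_univ_top fun k => ?_) b,
      stateMoment_before_top]
    have hk : χ k = χ (Fin.last n) := by
      by_contra hk
      exact (hempty ▸ hk : k ∈ (∅ : Set (Fin (n + 1))))
    rw [pos_left hs, pos_left (hk.trans hs)]
    omega
  · rw [T.state_mulRight_of_right hs, ← hbal _ _ (consecutive_univ_bot fun k => ?_) b,
      stateMoment_after_bot]
    have hk : χ k = χ (Fin.last n) := by
      by_contra hk
      exact (hempty ▸ hk : k ∈ (∅ : Set (Fin (n + 1))))
    rw [pos_right hs, pos_right (hk.trans hs)]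
    omega

/-- The next higher node `q` on the side of `p` is a neighbour along `≺_χ`: the preceding one on the
left, the following one on the right. If there is none, that neighbour is an end. -/
theorem momentFunction_propertyII (P : BBProbSpace B A) : PropertyII (momentFunction P) := by
  intro n χ T b p
  have hbal := balanced P (BNC.one χ).nonCrossing Finset.univ T.state T.state_adapted
  simp only [momentFunction_eq]
  have hpn := p.isLt
  refine ⟨fun q hq => ?_, fun hempty => ?_⟩
  · have hqp := Fin.lt_def.1 hq.1.2
    have hqs := hq.1.1
    have hmax : ∀ k, χ k = χ p → k.val < p.val → k.val ≤ q.val := fun k hk hlt => hq.2 ⟨hk, hlt⟩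
    rcases (χ p).left_or_right with hs | hs
    · rw [T.state_mulLeft_of_left hs, T.state_mulRight_of_left (hqs.trans hs)]
      refine (hbal _ _ (consecutive_univ_nodes ?_ fun k => ?_) b).symm
      · rw [pos_left hs, pos_left (hqs.trans hs)]
        exact hqp
      · rw [pos_left hs, pos_left (hqs.trans hs)]
        rcases pos_cases χ k with hk | hk
        · have := hmax k (hk.1.trans hs.symm)
          omega
        · omega
    · rw [T.state_mulLeft_of_right hs, T.state_mulRight_of_right (hqs.trans hs)]
      refine hbal _ _ (consecutive_univ_nodes ?_ fun k => ?_) b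
      · rw [pos_right hs, pos_right (hqs.trans hs)]
        omega
      · rw [pos_right hs, pos_right (hqs.trans hs)]
        rcases pos_cases χ k with hk | hk
        · omega
        · have := hmax k (hk.1.trans hs.symm)
          omega
  · have hmin : ∀ k, χ k = χ p → p.val ≤ k.val := by
      intro k hk
      by_contra hlt
      exact (hempty ▸ ⟨hk, Fin.lt_def.2 (not_le.1 hlt)⟩ : k ∈ (∅ : Set (Fin n)))
    refine ⟨fun hs => ?_, fun hs => ?_⟩
    · rw [T.state_mulLeft_of_left hs, ← hbal _ _ (consecutive_univ_bot fun k => ?_) b,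
        stateMoment_after_bot]
      rw [pos_left hs]
      rcases pos_cases χ k with hk | hk
      · have := hmin k (hk.1.trans hs.symm)
        omega
      · omega
    · rw [T.state_mulLeft_of_right hs, hbal _ _ (consecutive_univ_top fun k => ?_) b,
        stateMoment_before_top]
      rw [pos_right hs]
      rcases pos_cases χ k with hk | hk
      · omega
      · have := hmin k (hk.1.trans hs.symm)
        omega

theorem stateMoment_eq_prod_ofFn {π : Setoid (Fin n)} (hπ : NonCrossing χ π) (T : Tuple P χ)
    {m : ℕ} (V : Fin (m + 1) → Finset (Fin n)) {S : Finset (Fin n)} (hne : ∀ i, (V i).Nonempty)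
    (hV : ∀ i, ∀ j k, π.r j k → j ∈ V i → k ∈ V i) (hS : ∀ k, k ∈ S ↔ ∃ i, k ∈ V i)
    (hlt : ∀ i j, i < j → ∀ a ∈ V i, ∀ b ∈ V j, pos χ a < pos χ b) :
    stateMoment P χ π S T.state =
      (List.ofFn fun i => stateMoment P χ π (V i) T.state).prod := by
  induction m generalizing S with
  | zero =>
    have : S = V 0 := by
      ext k
      rw [hS]
      exact ⟨fun ⟨i, hi⟩ => (Fin.ext (by omega) : i = 0) ▸ hi, fun h => ⟨0, h⟩⟩
    simp [this]
  | succ m ih =>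
    have hsd : ∀ k, k ∈ S \ V 0 ↔ ∃ i : Fin (m + 1), k ∈ V i.succ := by
      intro k
      rw [Finset.mem_sdiff, hS, Fin.exists_fin_succ]
      refine ⟨fun h => h.1.resolve_left h.2, fun ⟨i, hi⟩ => ⟨Or.inr ⟨i, hi⟩, fun h₀ => ?_⟩⟩
      exact lt_irrefl _ (hlt 0 i.succ (Fin.succ_pos i) k h₀ k hi)
    have hafter : ∀ k ∈ S \ V 0, ∀ u ∈ V 0, pos χ u < pos χ k := by
      intro k hk u hu
      obtain ⟨i, hi⟩ := (hsd k).1 hk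
      exact hlt 0 i.succ (Fin.succ_pos i) u hu k hi
    obtain ⟨a, c, hac⟩ := exists_around (χ := χ) (hne 0) fun k hk u _ w hw _ h =>
      lt_asymm h (hafter k hk w hw)
    -- All remaining nodes follow the first interval, so only the lower end precedes it, and its
    -- value becomes a left factor.
    obtain rfl : a = .bot := by
      cases a with
      | bot => rfl
      | node k =>
        obtain ⟨u, hu⟩ := hne 0
        have h₁ := hac.left_lt u hu
        have h₂ := hafter k hac.left_isIn u hu
        simp only [Site.rank_node] at h₁
        omega
      | top => exact absurd rfl (hac.left_ne_top (hne 0))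
    have hW : (S \ V 0).Nonempty := by
      obtain ⟨u, hu⟩ := hne (Fin.succ 0)
      exact ⟨u, (hsd u).2 ⟨0, hu⟩⟩
    rw [stateMoment_remove hπ (fun k hk => (hS k).2 ⟨0, hk⟩) (hne 0) hW
      (fun i _ j hj hij => hV 0 j i (π.iseqv.symm hij) hj) hac T.state_adapted,
      stateMoment_after_bot, ih (fun i => V i.succ) (fun i => hne _) (fun i => hV _) hsd
      (fun i j hij => hlt _ _ (Fin.succ_lt_succ_iff.2 hij)), List.ofFn_succ (n := m + 1), List.prod_cons,
      stateMoment_state π (V 0)]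
    rfl

theorem momentFunction_propertyIII (P : BBProbSpace B A) : PropertyIII (momentFunction P) := by
  intro n χ T π hn m V hne _ hV hcover hlt
  simp only [momentFunction_restrict]
  rw [momentFunction_eq]
  cases m with
  | zero =>
    obtain ⟨i, -⟩ := hcover ⟨0, hn⟩
    exact i.elim0
  | succ m =>
    exact stateMoment_eq_prod_ofFn π.nonCrossing T V hne hV
      (fun k => ⟨fun _ => hcover k, fun _ => Finset.mem_univ k⟩)
      fun i j hij a ha b hb => prec_iff.1 (hlt i j hij a ha b hb)

theorem momentFunction_propertyIV (P : BBProbSpace B A) : PropertyIV (momentFunction P) := by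
  intro n χ T π V W hVW hV _ hint v₁ v₂ w₁ w₂ θ γ hv₁ hv₂ _ _ _ _ hθ hγ
  have hdisj := Finset.disjoint_left.1 hVW.disjoint
  have hsd : Finset.univ \ V = W := by
    rw [← Finset.compl_eq_univ_sdiff, hVW.compl_eq]
  have hle₁ : ∀ k ∈ V, pos χ v₁ ≤ pos χ k := fun k hk => by
    rcases eq_or_ne k v₁ with rfl | h
    · exact le_rfl
    · exact (prec_iff.1 (hv₁.2 k hk h)).le
  have hle₂ : ∀ k ∈ V, pos χ k ≤ pos χ v₂ := fun k hk => by
    rcases eq_or_ne k v₂ with rfl | h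
    · exact le_rfl
    · exact (prec_iff.1 (hv₂.2 k hk h)).le
  -- The nodes `θ` and `γ` are the neighbours of `V`: removal puts `x` after `θ`, and balance on `W`
  -- moves it before `γ`.
  have hac : Around χ Finset.univ V (.node θ) (.node γ) := by
    refine ⟨hsd ▸ hθ.1.1, hsd ▸ hγ.1.1, fun k hk => ?_, fun k hk => ?_, fun k hk => ?_⟩
    · exact Nat.succ_lt_succ ((prec_iff.1 hθ.1.2).trans_le (hle₁ k hk))
    · exact Nat.succ_lt_succ ((hle₂ k hk).trans_lt (prec_iff.1 hγ.1.2))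
    · rw [hsd] at hk
      have hkV : k ∉ V := fun h => hdisj h hk
      simp only [Site.rank_node, Nat.add_le_add_iff_right]
      rcases lt_trichotomy (pos χ k) (pos χ v₁) with h | h | h
      · left
        rcases eq_or_ne k θ with rfl | hne
        · exact le_rfl
        · exact (prec_iff.1 (hθ.2 k ⟨hk, prec_iff.2 h⟩ hne)).le
      · exact absurd (pos_injective h ▸ hv₁.1) hkV
      · rcases lt_trichotomy (pos χ k) (pos χ v₂) with h' | h' | h'
        · exact absurd (hint v₁ hv₁.1 v₂ hv₂.1 k (prec_iff.2 h) (prec_iff.2 h')) hkV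
        · exact absurd (pos_injective h' ▸ hv₂.1) hkV
        · right
          rcases eq_or_ne k γ with rfl | hne
          · exact le_rfl
          · exact (prec_iff.1 (hγ.2 k ⟨hk, prec_iff.2 h'⟩ hne)).le
  have hVne : V.Nonempty := ⟨v₁, hv₁.1⟩
  intro x ΦW
  have hx : x = momentOn P χ π.rel V T.state.T := by
    refine (momentFunction_restrict π T V).trans ?_
    rw [stateMoment_state]
    rfl
  have hΦW : ∀ T', ΦW T' = stateMoment P χ π.rel W T'.state := fun T' =>
    momentFunction_restrict π T' W
  have hafter : momentFunction P χ π T =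
      stateMoment P χ π.rel W (T.state.after P χ (.node θ) x) := by
    rw [momentFunction_eq, hx, stateMoment_remove π.nonCrossing (Finset.subset_univ V) hVne
      (hsd ▸ ⟨θ, hθ.1.1⟩) (fun i _ j hj hij => hV j i (π.rel.iseqv.symm hij) hj) hac
      T.state_adapted, hsd]
  have hbefore : momentFunction P χ π T =
      stateMoment P χ π.rel W (T.state.before P χ (.node γ) x) := by
    rw [hafter, balanced P π.nonCrossing W T.state T.state_adapted _ _
      (hsd ▸ hac.consecutive hVne)]
  simp only [hΦW]
  exact ⟨fun h => by rw [T.state_mulRight_of_left h, hafter],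
    fun h => by rw [T.state_mulLeft_of_right h, hafter],
    fun h => by rw [T.state_mulLeft_of_left h, hbefore],
    fun h => by rw [T.state_mulRight_of_right h, hbefore]⟩

end Main

end BiFree

end

theorem mainTheorem3 {B A : Type*} [Ring B] [Algebra ℂ B] [Ring A] [Algebra ℂ A]
    (P : BiFree.BBProbSpace B A) :
    BiFree.IsBiMultiplicative (BiFree.momentFunction P) where
  map_add n χ π T k x y := by
    obtain ⟨f, hf⟩ := BiFree.exists_momentOn_update_eq P (χ := χ) (π := π.rel)
      (Finset.mem_univ k) fun j => (T j : A)
    simp only [BiFree.momentFunction, BiFree.recMoment, BiFree.Tuple.coe_update, hf]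
    exact map_add f _ _
  map_smul n χ π T k a x := by
    obtain ⟨f, hf⟩ := BiFree.exists_momentOn_update_eq P (χ := χ) (π := π.rel)
      (Finset.mem_univ k) fun j => (T j : A)
    simp only [BiFree.momentFunction, BiFree.recMoment, BiFree.Tuple.coe_update, hf]
    exact map_smul f _ _
  property_i := BiFree.momentFunction_propertyI P
  property_ii := BiFree.momentFunction_propertyII P
  property_iii := BiFree.momentFunction_propertyIII P
  property_iv := BiFree.momentFunction_propertyIV P
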